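/- All Lie algebras are over $\mathbb C$. A \emph{quadratic Lie algebra} $(\mathfrak g,B)$ is a Lie algebra $\mathfrak g$ with a symmetric, non-degenerate bilinear form $B$ that is invariant, i.e. $B([X,Y],Z)=B(X,[Y,Z])$ for all $X,Y,Z$. It is \emph{indecomposable} if whenever $\mathfrak g=\mathfrak g_1\oplus\mathfrak g_2$ with $\mathfrak g_1,\mathfrak g_2$ ideals orthogonal with respect to $B$, one of $\mathfrak g_1,\mathfrak g_2$ is zero. Two quadratic Lie algebras $(\mathfrak g,B)$ and $(\mathfrak g',B')$ are \emph{i-isomorphic} if there is a Lie algebra isomorphism $A:\mathfrak g\to\mathfrak g'$ with $B'(A(X),A(Y))=B(X,Y)$ for all $X,Y\in\mathfrak g$. On the space $\mathbb C^6$ with basis $\{Z_1,Z_2,Z_3,X_1,X_2,X_3\}$ and with the symmetric bilinear form given by $B(X_i,Z_j)=\delta_{ij}$, $B(Z_i,Z_j)=B(X_i,X_j)=0$ $(1\le i,j\le 3)$, consider the following quadratic Lie algebras, where the brackets of basis vectors that are not determined by those listed are zero: \begin{itemize} \item[(i)] $\mathfrak g_{6,1}$: $[X_3,Z_2]=Z_1$,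 $[X_3,X_1]=-X_2$, $[Z_2,X_1]=Z_3$; \item[(ii)] $\mathfrak g_{6,2}(\lambda)$, for $\lambda\in\mathbb C$, $\lambda\ne0$: $[X_3,Z_1]=Z_1$, $[X_3,Z_2]=\lambda Z_2$, $[X_3,X_1]=-X_1$, $[X_3,X_2]=-\lambda X_2$, $[Z_1,X_1]=Z_3$, $[Z_2,X_2]=\lambda Z_3$; \item[(iii)] $\mathfrak g_{6,3}$: $[X_3,Z_1]=Z_1$, $[X_3,Z_2]=Z_1+Z_2$, $[X_3,X_1]=-X_1-X_2$, $[X_3,X_2]=-X_2$, $[Z_1,X_1]=[Z_2,X_1]=[Z_2,X_2]=Z_3$. \end{itemize} \textbf{Proposition.} Every indecomposable solvable quadratic Lie algebra $(\mathfrak g,B)$ of dimension $6$ is i-isomorphic to $\mathfrak g_{6,1}$, to $\mathfrak g_{6,2}(\lambda)$ for some $\lambda\neq 0$, or to $\mathfrak g_{6,3}$. No two Lie algebras taken from different families among these three are i-isomorphic, so exactly one of the three cases occurs. Moreover, for $\lambda_1,\lambda_2\in\mathbb C\setminus\{0\}$, $\mathfrak g_{6,2}(\lambda_1)$ and $\mathfrak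 g_{6,2}(\lambda_2)$ are i-isomorphic if and only if $\lambda_2=\pm\lambda_1$ or $\lambda_2=\pm\lambda_1^{-1}$. -/

import Mathlib

open scoped Matrix

namespace QuadLie

section General

variable {𝔤 : Type*} [LieRing 𝔤] [LieAlgebra ℂ 𝔤]

/-- `(𝔤, B)` is a quadratic Lie algebra: `B` is symmetric, non-degenerate and invariant. -/
structure IsQuadratic (B : LinearMap.BilinForm ℂ 𝔤) : Prop where
  symm : ∀ x y : 𝔤, B x y = B y x
  nondegenerate : ∀ x : 𝔤, (∀ y : 𝔤, B x y = 0) → x = 0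
  invariant : ∀ x y z : 𝔤, B ⁅x, y⁆ z = B x ⁅y, z⁆

/-- `(𝔤, B)` is indecomposable: in every decomposition of `𝔤` as a direct sum of two ideals
that are orthogonal for `B`, one of the two ideals is zero. -/
def IsIndecomposable (B : LinearMap.BilinForm ℂ 𝔤) : Prop :=
  ∀ I J : LieIdeal ℂ 𝔤, IsCompl I J → (∀ x ∈ I, ∀ y ∈ J, B x y = 0) → I = ⊥ ∨ J = ⊥

/-- `(𝔤, B)` and `(𝔥, B')` are i-isomorphic: some isomorphism of Lie algebras is an isometry. -/
def IIsomorphic {𝔥 : Type*} [LieRing 𝔥] [LieAlgebra ℂ 𝔥]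
    (B : LinearMap.BilinForm ℂ 𝔤) (B' : LinearMap.BilinForm ℂ 𝔥) : Prop :=
  ∃ A : 𝔤 ≃ₗ⁅ℂ⁆ 𝔥, ∀ x y : 𝔤, B' (A x) (A y) = B x y

end General

/-- The six-dimensional space with basis `Z₁, Z₂, Z₃, X₁, X₂, X₃`; the pair `(z, x)` stands for
`∑ zᵢ Zᵢ + ∑ xᵢ Xᵢ`, the indices `1, 2, 3` being `0, 1, 2` in `Fin 3`. The matrix `M` determines
the Lie bracket that is put on this space below. -/
@[nolint unusedArguments]
def Model (_M : Matrix (Fin 2) (Fin 2) ℂ) : Type := (Fin 3 → ℂ) × (Fin 3 → ℂ)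

namespace Model

variable (M : Matrix (Fin 2) (Fin 2) ℂ)

instance : AddCommGroup (Model M) := inferInstanceAs (AddCommGroup ((Fin 3 → ℂ) × (Fin 3 → ℂ)))

instance : Module ℂ (Model M) := inferInstanceAs (Module ℂ ((Fin 3 → ℂ) × (Fin 3 → ℂ)))

/-- The basis vector `Zᵢ`. -/
def Z (i : Fin 3) : Model M := (Pi.single i 1, 0)

/-- The basis vector `Xᵢ`. -/
def X (i : Fin 3) : Model M := (0, Pi.single i 1)

/-- The bracket with `[X₃, Zⱼ] = ∑ᵢ Mᵢⱼ Zᵢ`, `[X₃, Xⱼ] = - ∑ᵢ Mⱼᵢ Xᵢ` and `[Zᵢ, Xⱼ] = Mⱼᵢ Z₃`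
for `i, j ∈ {1, 2}`, the other brackets of basis vectors being zero, in coordinates. -/
instance : Bracket (Model M) (Model M) where
  bracket u v :=
    (![M 0 0 * (u.2 2 * v.1 0 - v.2 2 * u.1 0) + M 0 1 * (u.2 2 * v.1 1 - v.2 2 * u.1 1),
       M 1 0 * (u.2 2 * v.1 0 - v.2 2 * u.1 0) + M 1 1 * (u.2 2 * v.1 1 - v.2 2 * u.1 1),
       M 0 0 * (u.1 0 * v.2 0 - v.1 0 * u.2 0) + M 1 0 * (u.1 0 * v.2 1 - v.1 0 * u.2 1) +
         M 0 1 * (u.1 1 * v.2 0 - v.1 1 * u.2 0) + M 1 1 * (u.1 1 * v.2 1 - v.1 1 * u.2 1)],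
     ![-(M 0 0 * (u.2 2 * v.2 0 - v.2 2 * u.2 0) + M 1 0 * (u.2 2 * v.2 1 - v.2 2 * u.2 1)),
       -(M 0 1 * (u.2 2 * v.2 0 - v.2 2 * u.2 0) + M 1 1 * (u.2 2 * v.2 1 - v.2 2 * u.2 1)),
       0])

variable {M}

theorem lie_fst_zero (u v : Model M) : ⁅u, v⁆.1 0 =
    M 0 0 * (u.2 2 * v.1 0 - v.2 2 * u.1 0) + M 0 1 * (u.2 2 * v.1 1 - v.2 2 * u.1 1) := rfl

theorem lie_fst_one (u v : Model M) : ⁅u, v⁆.1 1 =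
    M 1 0 * (u.2 2 * v.1 0 - v.2 2 * u.1 0) + M 1 1 * (u.2 2 * v.1 1 - v.2 2 * u.1 1) := rfl

theorem lie_fst_two (u v : Model M) : ⁅u, v⁆.1 2 =
    M 0 0 * (u.1 0 * v.2 0 - v.1 0 * u.2 0) + M 1 0 * (u.1 0 * v.2 1 - v.1 0 * u.2 1) +
      M 0 1 * (u.1 1 * v.2 0 - v.1 1 * u.2 0) + M 1 1 * (u.1 1 * v.2 1 - v.1 1 * u.2 1) := rfl

theorem lie_snd_zero (u v : Model M) : ⁅u, v⁆.2 0 =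
    -(M 0 0 * (u.2 2 * v.2 0 - v.2 2 * u.2 0) + M 1 0 * (u.2 2 * v.2 1 - v.2 2 * u.2 1)) := rfl

theorem lie_snd_one (u v : Model M) : ⁅u, v⁆.2 1 =
    -(M 0 1 * (u.2 2 * v.2 0 - v.2 2 * u.2 0) + M 1 1 * (u.2 2 * v.2 1 - v.2 2 * u.2 1)) := rfl

theorem lie_snd_two (u v : Model M) : ⁅u, v⁆.2 2 = 0 := rfl

theorem ext' {u v : Model M} (h₁ : ∀ i, u.1 i = v.1 i) (h₂ : ∀ i, u.2 i = v.2 i) : u = v :=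
  Prod.ext (funext h₁) (funext h₂)

@[simp] theorem add_fst (u v : Model M) (i : Fin 3) : (u + v).1 i = u.1 i + v.1 i := rfl

@[simp] theorem add_snd (u v : Model M) (i : Fin 3) : (u + v).2 i = u.2 i + v.2 i := rfl

@[simp] theorem sub_fst (u v : Model M) (i : Fin 3) : (u - v).1 i = u.1 i - v.1 i := rfl

@[simp] theorem sub_snd (u v : Model M) (i : Fin 3) : (u - v).2 i = u.2 i - v.2 i := rfl

@[simp] theorem neg_fst (u : Model M) (i : Fin 3) : (-u).1 i = -u.1 i := rfl

@[simp] theorem neg_snd (u : Model M) (i : Fin 3) : (-u).2 i = -u.2 i := rfl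

@[simp] theorem zero_fst (i : Fin 3) : (0 : Model M).1 i = 0 := rfl

@[simp] theorem zero_snd (i : Fin 3) : (0 : Model M).2 i = 0 := rfl

@[simp] theorem smul_fst (t : ℂ) (u : Model M) (i : Fin 3) : (t • u).1 i = t * u.1 i := rfl

@[simp] theorem smul_snd (t : ℂ) (u : Model M) (i : Fin 3) : (t • u).2 i = t * u.2 i := rfl

@[simp] theorem Z_fst (i j : Fin 3) : (Z M i).1 j = if j = i then 1 else 0 := by
  simp [Z, Pi.single_apply]

@[simp] theorem Z_snd (i j : Fin 3) : (Z M i).2 j = 0 := rfl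

@[simp] theorem X_fst (i j : Fin 3) : (X M i).1 j = 0 := rfl

@[simp] theorem X_snd (i j : Fin 3) : (X M i).2 j = if j = i then 1 else 0 := by
  simp [X, Pi.single_apply]

variable (M)

instance : LieRing (Model M) where
  add_lie u v w := by
    apply ext' <;> intro i <;> fin_cases i <;>
      simp [lie_fst_zero, lie_fst_one, lie_fst_two, lie_snd_zero, lie_snd_one,
        lie_snd_two] <;> ring
  lie_add u v w := by
    apply ext' <;> intro i <;> fin_cases i <;>
      simp [lie_fst_zero, lie_fst_one, lie_fst_two, lie_snd_zero, lie_snd_one,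
        lie_snd_two] <;> ring
  lie_self u := by
    apply ext' <;> intro i <;> fin_cases i <;>
      simp [lie_fst_zero, lie_fst_one, lie_fst_two, lie_snd_zero, lie_snd_one,
        lie_snd_two]
  leibniz_lie u v w := by
    apply ext' <;> intro i <;> fin_cases i <;>
      simp [lie_fst_zero, lie_fst_one, lie_fst_two, lie_snd_zero, lie_snd_one,
        lie_snd_two] <;> ring

instance : LieAlgebra ℂ (Model M) where
  lie_smul t u v := by
    apply ext' <;> intro i <;> fin_cases i <;>
      simp [lie_fst_zero, lie_fst_one, lie_fst_two, lie_snd_zero, lie_snd_one,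
        lie_snd_two] <;> ring

/-- The brackets of the basis vectors with `X₃`. -/
theorem lie_X_two :
    ⁅X M 2, Z M 0⁆ = M 0 0 • Z M 0 + M 1 0 • Z M 1 ∧
    ⁅X M 2, Z M 1⁆ = M 0 1 • Z M 0 + M 1 1 • Z M 1 ∧
    ⁅X M 2, X M 0⁆ = -(M 0 0 • X M 0) - M 0 1 • X M 1 ∧
    ⁅X M 2, X M 1⁆ = -(M 1 0 • X M 0) - M 1 1 • X M 1 := by
  refine ⟨?_, ?_, ?_, ?_⟩ <;>
    (apply ext' <;> intro i <;> fin_cases i <;>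
      simp [lie_fst_zero, lie_fst_one, lie_fst_two, lie_snd_zero, lie_snd_one,
        lie_snd_two])

/-- The brackets `[Zᵢ, Xⱼ]` for `i, j ∈ {1, 2}`. -/
theorem lie_Z_X :
    ⁅Z M 0, X M 0⁆ = M 0 0 • Z M 2 ∧ ⁅Z M 0, X M 1⁆ = M 1 0 • Z M 2 ∧
    ⁅Z M 1, X M 0⁆ = M 0 1 • Z M 2 ∧ ⁅Z M 1, X M 1⁆ = M 1 1 • Z M 2 := by
  refine ⟨?_, ?_, ?_, ?_⟩ <;>
    (apply ext' <;> intro i <;> fin_cases i <;>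
      simp [lie_fst_zero, lie_fst_one, lie_fst_two, lie_snd_zero, lie_snd_one,
        lie_snd_two])

/-- The other brackets of basis vectors are zero. -/
theorem lie_eq_zero :
    (∀ j k, ⁅Z M j, Z M k⁆ = 0) ∧ (∀ j, ⁅Z M 2, X M j⁆ = 0) ∧ ⁅X M 0, X M 1⁆ = 0 := by
  refine ⟨fun j k => ?_, fun j => ?_, ?_⟩ <;>
    (apply ext' <;> intro i <;> fin_cases i <;>
      simp [lie_fst_zero, lie_fst_one, lie_fst_two, lie_snd_zero, lie_snd_one,
        lie_snd_two])

/-- The bilinear form with `B(Xᵢ, Zⱼ) = B(Zⱼ, Xᵢ) = δᵢⱼ` and `B(Zᵢ, Zⱼ) = B(Xᵢ, Xⱼ) = 0`. -/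
noncomputable def form : LinearMap.BilinForm ℂ (Model M) :=
  LinearMap.mk₂ ℂ (fun u v => ∑ i, (u.1 i * v.2 i + u.2 i * v.1 i))
    (fun u u' v => by simp only [Fin.sum_univ_three, add_fst, add_snd]; ring)
    (fun t u v => by simp only [Fin.sum_univ_three, smul_fst, smul_snd, smul_eq_mul]; ring)
    (fun u v v' => by simp only [Fin.sum_univ_three, add_fst, add_snd]; ring)
    (fun t u v => by simp only [Fin.sum_univ_three, smul_fst, smul_snd, smul_eq_mul]; ring)

theorem form_apply (u v : Model M) : form M u v = ∑ i, (u.1 i * v.2 i + u.2 i * v.1 i) := rfl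

theorem form_isQuadratic : IsQuadratic (form M) where
  symm u v := by simp only [form_apply, Fin.sum_univ_three]; ring
  nondegenerate u h := by
    apply ext' <;> intro i
    · have h' := h (X M i)
      fin_cases i <;> simpa [form_apply, Fin.sum_univ_three] using h'
    · have h' := h (Z M i)
      fin_cases i <;> simpa [form_apply, Fin.sum_univ_three] using h'
  invariant u v w := by
    simp [form_apply, lie_fst_zero, lie_fst_one, lie_fst_two, lie_snd_zero,
      lie_snd_one, lie_snd_two, Fin.sum_univ_three]; ring

end Model

/-- `𝔤₆,₁`: `[X₃, Z₂] = Z₁`, `[X₃, X₁] = -X₂`, `[Z₂, X₁] = Z₃`, otherwise trivial. -/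
abbrev G61 : Type := Model !![0, 1; 0, 0]

/-- `𝔤₆,₂(c)`: `[X₃, Z₁] = Z₁`, `[X₃, Z₂] = c Z₂`, `[X₃, X₁] = -X₁`, `[X₃, X₂] = -c X₂`,
`[Z₁, X₁] = Z₃`, `[Z₂, X₂] = c Z₃`, otherwise trivial. -/
abbrev G62 (c : ℂ) : Type := Model !![1, 0; 0, c]

/-- `𝔤₆,₃`: `[X₃, Z₁] = Z₁`, `[X₃, Z₂] = Z₁ + Z₂`, `[X₃, X₁] = -X₁ - X₂`, `[X₃, X₂] = -X₂`,
`[Z₁, X₁] = [Z₂, X₁] = [Z₂, X₂] = Z₃`, otherwise trivial. -/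
abbrev G63 : Type := Model !![1, 1; 0, 1]

/-- The standard forms on the three families. -/
noncomputable abbrev B61 : LinearMap.BilinForm ℂ G61 := Model.form _

noncomputable abbrev B62 (c : ℂ) : LinearMap.BilinForm ℂ (G62 c) := Model.form _

noncomputable abbrev B63 : LinearMap.BilinForm ℂ G63 := Model.form _

end QuadLie

/-! Invariance makes `B ⁅x, y⁆ w` an alternating trilinear form, and the center is the orthogonal of
the derived algebra. A non-isotropic central vector spans an ideal that splits off orthogonally, so
indecomposability enters only through the center being totally isotropic (`isotropic_of_central`).
Solvability supplies a central `z ≠ 0`; let `d` be an isotropic partner of it.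

The main point (`exists_isDoubleExtension`) is that `z` can be chosen with `z^⊥ / ℂ z` abelian: an
alternating trilinear form on the 5-dimensional `z^⊥` is zero once its kernel has dimension three.
If the center is a line, Lie's theorem provides the kernel vectors; otherwise a second central
vector does, possibly after changing `z`.

What remains is the skew map induced by `ad d` on a 4-dimensional quadratic space. A nonzero
eigenvalue, scaled to 1, leads to a block `diag(1, c)` or a Jordan block; if there is none, the
nilpotent case gives `G61`. Isotropy of the center excludes the degenerate maps (`classification`).

The families are separated by Lie algebra invariants alone: eigenvalues of `ad u` and failure of
semisimplicity. -/

namespace QuadLie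

/-! ### Invariant forms and hyperbolic families. -/

section Basics

variable {𝔤 : Type*} [LieRing 𝔤] [LieAlgebra ℂ 𝔤] {B : LinearMap.BilinForm ℂ 𝔤}

namespace IsQuadratic

theorem lie_left_comm (hB : IsQuadratic B) (x y z : 𝔤) : B ⁅x, y⁆ z = B ⁅y, z⁆ x := by
  rw [hB.invariant, hB.symm]

theorem lie_skew (hB : IsQuadratic B) (x y z : 𝔤) : B ⁅x, y⁆ z = -B ⁅x, z⁆ y := by
  rw [hB.lie_left_comm, hB.lie_left_comm x z y, ← _root_.lie_skew y z, map_neg,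
    LinearMap.neg_apply]

theorem lie_apply_right_self (hB : IsQuadratic B) (x y : 𝔤) : B ⁅x, y⁆ y = 0 := by
  rw [hB.lie_left_comm, lie_self, map_zero, LinearMap.zero_apply]

theorem eq_of_forall (hB : IsQuadratic B) {x y : 𝔤} (h : ∀ w, B x w = B y w) : x = y :=
  sub_eq_zero.1 <| hB.nondegenerate _ fun w => by simp [h w]

theorem exists_apply_eq_one (hB : IsQuadratic B) {x : 𝔤} (hx : x ≠ 0) : ∃ y, B x y = 1 := by
  by_contra! h
  refine hx (hB.nondegenerate x fun y => by_contra fun hy => h ((B x y)⁻¹ • y) ?_)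
  simp [hy]

/-- A nonzero isotropic vector is part of a hyperbolic pair. -/
theorem exists_isotropic_partner (hB : IsQuadratic B) {x : 𝔤} (hx : x ≠ 0) (hxx : B x x = 0) :
    ∃ y, B x y = 1 ∧ B y y = 0 := by
  obtain ⟨y, hy⟩ := hB.exists_apply_eq_one hx
  have hyx : B y x = 1 := by rw [hB.symm, hy]
  refine ⟨y - (B y y / 2) • x, ?_, ?_⟩
  · simp [hy, hxx]
  · simp only [map_sub, map_smul, LinearMap.sub_apply, LinearMap.smul_apply, smul_eq_mul, hy, hyx,
      hxx]
    ring

/-- Every linear functional is represented by the form. -/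
theorem exists_forall_apply_eq [FiniteDimensional ℂ 𝔤] (hB : IsQuadratic B)
    (f : Module.Dual ℂ 𝔤) : ∃ y, ∀ x, B y x = f x := by
  have hinj : Function.Injective (B : 𝔤 →ₗ[ℂ] Module.Dual ℂ 𝔤) := by
    refine (injective_iff_map_eq_zero _).2 fun x hx => hB.nondegenerate x fun y => ?_
    rw [hx, LinearMap.zero_apply]
  obtain ⟨y, hy⟩ := (LinearMap.injective_iff_surjective_of_finrank_eq_finrank
    (Subspace.dual_finrank_eq (K := ℂ) (V := 𝔤)).symm).1 hinj f
  exact ⟨y, fun x => by rw [hy]⟩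

end IsQuadratic

/-- The subspace of the vectors orthogonal to all `w i`. -/
def perp (B : LinearMap.BilinForm ℂ 𝔤) {n : ℕ} (w : Fin n → 𝔤) : Submodule ℂ 𝔤 :=
  LinearMap.ker (LinearMap.pi fun i => B.flip (w i))

theorem mem_perp {n : ℕ} {w : Fin n → 𝔤} {x : 𝔤} : x ∈ perp B w ↔ ∀ i, B x (w i) = 0 := by
  simp [perp, funext_iff]

theorem finrank_le_finrank_perp_add [FiniteDimensional ℂ 𝔤] {n : ℕ} (w : Fin n → 𝔤) :
    Module.finrank ℂ 𝔤 ≤ Module.finrank ℂ (perp B w) + n := by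
  have h := LinearMap.finrank_range_add_finrank_ker (LinearMap.pi fun i => B.flip (w i))
  have h' := Submodule.finrank_le (LinearMap.range (LinearMap.pi fun i => B.flip (w i)))
  rw [Module.finrank_fin_fun] at h'
  rw [perp]
  omega

/-- A subspace of dimension at least two contains a nonzero isotropic vector. -/
theorem exists_isotropic (hB : IsQuadratic B) (U : Submodule ℂ 𝔤)
    (hU : 1 < Module.finrank ℂ U) : ∃ p ∈ U, p ≠ 0 ∧ B p p = 0 := by
  have : Nontrivial U := Module.nontrivial_of_finrank_pos (R := ℂ) (by omega)
  obtain ⟨⟨p, hp⟩, hp0⟩ := exists_ne (0 : U)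
  have hp0' : p ≠ 0 := by simpa using hp0
  by_cases hpp : B p p = 0
  · exact ⟨p, hp, hp0', hpp⟩
  obtain ⟨q, hq, hqp⟩ : ∃ q ∈ U, q ∉ Submodule.span ℂ {p} := by
    by_contra! h
    have h1 := Submodule.finrank_mono (show U ≤ Submodule.span ℂ {p} from h)
    rw [finrank_span_singleton hp0'] at h1
    omega
  -- `t` is a root of `B (q + t • p) (q + t • p)`, quadratic in `t` with leading coefficient `B p
  -- p`.
  obtain ⟨s, hs⟩ := IsAlgClosed.exists_eq_mul_self (discrim (B p p) (2 * B p q) (B q q))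
  obtain ⟨t, ht⟩ := exists_quadratic_eq_zero hpp ⟨s, hs⟩
  refine ⟨q + t • p, U.add_mem hq (U.smul_mem t hp), fun h => hqp ?_, ?_⟩
  · rw [eq_neg_of_add_eq_zero_left h]
    exact Submodule.neg_mem _ (Submodule.smul_mem _ _ (Submodule.mem_span_singleton_self p))
  · simp only [map_add, map_smul, LinearMap.add_apply, LinearMap.smul_apply, smul_eq_mul,
      hB.symm q p]
    linear_combination ht

/-- The vectors `z₁, z₂, z₃, x₁, x₂, x₃` have the Gram matrix of the standard basis of `Model M`. -/
def IsHyperbolic (B : LinearMap.BilinForm ℂ 𝔤) (z₁ z₂ z₃ x₁ x₂ x₃ : 𝔤) : Prop :=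
  (B z₁ z₁ = 0 ∧ B z₁ z₂ = 0 ∧ B z₁ z₃ = 0 ∧ B z₂ z₂ = 0 ∧ B z₂ z₃ = 0 ∧ B z₃ z₃ = 0) ∧
  (B x₁ x₁ = 0 ∧ B x₁ x₂ = 0 ∧ B x₁ x₃ = 0 ∧ B x₂ x₂ = 0 ∧ B x₂ x₃ = 0 ∧ B x₃ x₃ = 0) ∧
  (B z₁ x₁ = 1 ∧ B z₁ x₂ = 0 ∧ B z₁ x₃ = 0) ∧ (B z₂ x₁ = 0 ∧ B z₂ x₂ = 1 ∧ B z₂ x₃ = 0) ∧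
  (B z₃ x₁ = 0 ∧ B z₃ x₂ = 0 ∧ B z₃ x₃ = 1)

namespace IsHyperbolic

variable {z₁ z₂ z₃ x₁ x₂ x₃ : 𝔤}

theorem flip (h : IsHyperbolic B z₁ z₂ z₃ x₁ x₂ x₃) (hB : IsQuadratic B) :
    (B z₂ z₁ = 0 ∧ B z₃ z₁ = 0 ∧ B z₃ z₂ = 0) ∧ (B x₂ x₁ = 0 ∧ B x₃ x₁ = 0 ∧ B x₃ x₂ = 0) ∧
    (B x₁ z₁ = 1 ∧ B x₂ z₁ = 0 ∧ B x₃ z₁ = 0) ∧ (B x₁ z₂ = 0 ∧ B x₂ z₂ = 1 ∧ B x₃ z₂ = 0) ∧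
    (B x₁ z₃ = 0 ∧ B x₂ z₃ = 0 ∧ B x₃ z₃ = 1) := by
  simp only [IsHyperbolic] at h
  refine ⟨⟨?_, ?_, ?_⟩, ⟨?_, ?_, ?_⟩, ⟨?_, ?_, ?_⟩, ⟨?_, ?_, ?_⟩, ⟨?_, ?_, ?_⟩⟩ <;>
    rw [hB.symm] <;> simp only [h]

theorem swap (h : IsHyperbolic B z₁ z₂ z₃ x₁ x₂ x₃) (hB : IsQuadratic B) :
    IsHyperbolic B z₁ x₂ z₃ x₁ z₂ x₃ := by
  have h' := h.flip hB
  simp only [IsHyperbolic] at h ⊢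
  simp only [h, h', and_self]

theorem smul_fst (h : IsHyperbolic B z₁ z₂ z₃ x₁ x₂ x₃) {m : ℂ} (hm : m ≠ 0) :
    IsHyperbolic B (m • z₁) z₂ z₃ (m⁻¹ • x₁) x₂ x₃ := by
  simp only [IsHyperbolic] at h ⊢
  simp [h, hm]

theorem smul_third (h : IsHyperbolic B z₁ z₂ z₃ x₁ x₂ x₃) {m : ℂ} (hm : m ≠ 0) :
    IsHyperbolic B z₁ z₂ (m • z₃) x₁ x₂ (m⁻¹ • x₃) := by
  simp only [IsHyperbolic] at h ⊢
  simp [h, hm]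

/-- An isometry fixing `z₁`; the change in `x₁` compensates the multiples of `z₁` added elsewhere.
Later `r` diagonalizes `ad d` on the span of `z₁, z₂`, and `s` removes the term `B ⁅d, x₁⁆ x₂`. -/
theorem shear (h : IsHyperbolic B z₁ z₂ z₃ x₁ x₂ x₃) (hB : IsQuadratic B) (r s : ℂ) :
    IsHyperbolic B z₁ (z₂ + r • z₁) z₃ (x₁ - s • z₂ - r • x₂ - (r * s) • z₁) (x₂ + s • z₁) x₃ := by
  have h' := h.flip hB
  simp only [IsHyperbolic] at h ⊢
  simp only [map_add, map_sub, map_smul, LinearMap.add_apply, LinearMap.sub_apply,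
    LinearMap.smul_apply, smul_eq_mul, h, h']
  ring_nf
  simp

/-- The family `z₁, z₂, z₃, x₁, x₂, x₃` is linearly independent. -/
theorem linearIndependent (h : IsHyperbolic B z₁ z₂ z₃ x₁ x₂ x₃) (hB : IsQuadratic B) :
    LinearIndependent ℂ ![z₁, z₂, z₃, x₁, x₂, x₃] := by
  have h' := h.flip hB
  simp only [IsHyperbolic] at h
  rw [Fintype.linearIndependent_iff]
  intro g hg
  have key : ∀ w, B (∑ i, g i • ![z₁, z₂, z₃, x₁, x₂, x₃] i) w = 0 := fun w => by
    rw [hg, map_zero, LinearMap.zero_apply]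
  simp only [Fin.sum_univ_six] at key
  intro i
  fin_cases i
  · simpa [h, h'] using key x₁
  · simpa [h, h'] using key x₂
  · simpa [h, h'] using key x₃
  · simpa [h, h'] using key z₁
  · simpa [h, h'] using key z₂
  · simpa [h, h'] using key z₃

theorem expand (h : IsHyperbolic B z₁ z₂ z₃ x₁ x₂ x₃) (hB : IsQuadratic B)
    (hdim : Module.finrank ℂ 𝔤 = 6) (u : 𝔤) :
    u = B u x₁ • z₁ + B u x₂ • z₂ + B u x₃ • z₃ + B u z₁ • x₁ + B u z₂ • x₂ + B u z₃ • x₃ := by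
  have hli := h.linearIndependent hB
  have h' := h.flip hB
  simp only [IsHyperbolic] at h
  let b := basisOfLinearIndependentOfCardEqFinrank hli (by simp [hdim])
  have hb : ∀ i, b i = ![z₁, z₂, z₃, x₁, x₂, x₃] i := fun i => by simp [b]
  have hu := b.sum_repr u
  simp only [Fin.sum_univ_six, hb] at hu
  rw [← hu]
  simp [h, h']

end IsHyperbolic

/-- A hyperbolic pair `z, d` and a nonzero isotropic vector orthogonal to it extend to a hyperbolic
family. -/
theorem exists_isHyperbolic (hB : IsQuadratic B) (hdim : Module.finrank ℂ 𝔤 = 6) {z d v : 𝔤}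
    (hzz : B z z = 0) (hzd : B z d = 1) (hdd : B d d = 0) (hv : v ≠ 0) (hvv : B v v = 0)
    (hvz : B v z = 0) (hvd : B v d = 0) : ∃ p x q, IsHyperbolic B v p z x q d := by
  have : FiniteDimensional ℂ 𝔤 := Module.finite_of_finrank_eq_succ hdim
  have hdz : B d z = 1 := by rw [hB.symm, hzd]
  have hzv : B z v = 0 := by rw [hB.symm, hvz]
  have hdv : B d v = 0 := by rw [hB.symm, hvd]
  obtain ⟨x, hx, hxx, hxz, hxd⟩ : ∃ x, B v x = 1 ∧ B x x = 0 ∧ B x z = 0 ∧ B x d = 0 := by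
    obtain ⟨y, hy⟩ := hB.exists_apply_eq_one hv
    obtain ⟨y', hy', hyz, hyd⟩ : ∃ y', B v y' = 1 ∧ B y' z = 0 ∧ B y' d = 0 := by
      refine ⟨y - B y d • z - B y z • d, ?_, ?_, ?_⟩ <;> simp [*]
    have hyv : B y' v = 1 := by rw [hB.symm, hy']
    refine ⟨y' - (B y' y' / 2) • v, ?_, ?_, ?_, ?_⟩
    · simp [*]
    · simp only [map_sub, map_smul, LinearMap.sub_apply, LinearMap.smul_apply, smul_eq_mul, *]
      ring
    · simp [*]
    · simp [*]
  have hzx : B z x = 0 := by rw [hB.symm, hxz]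
  have hdx : B d x = 0 := by rw [hB.symm, hxd]
  have hxv : B x v = 1 := by rw [hB.symm, hx]
  -- Four conditions in dimension six leave at least a plane.
  obtain ⟨p, hp, hp0, hpp⟩ := exists_isotropic hB (perp B ![z, d, v, x]) (by
    have := finrank_le_finrank_perp_add (B := B) ![z, d, v, x]
    omega)
  rw [mem_perp] at hp
  have hpz : B p z = 0 := hp 0
  have hpd : B p d = 0 := hp 1
  have hpv : B p v = 0 := hp 2
  have hpx : B p x = 0 := hp 3
  obtain ⟨q, hq, hqz, hqd, hqv, hqx⟩ :
      ∃ q, B p q = 1 ∧ B q z = 0 ∧ B q d = 0 ∧ B q v = 0 ∧ B q x = 0 := by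
    obtain ⟨y, hy⟩ := hB.exists_apply_eq_one hp0
    refine ⟨y - B y d • z - B y z • d - B y v • x - B y x • v, ?_, ?_, ?_, ?_, ?_⟩ <;> simp [*]
  have hqp : B q p = 1 := by rw [hB.symm, hq]
  refine ⟨p, x, q - (B q q / 2) • p, ?_⟩
  simp only [IsHyperbolic]
  simp only [map_sub, map_smul, LinearMap.sub_apply, LinearMap.smul_apply, smul_eq_mul, *,
    hB.symm v p, hB.symm z p, hB.symm x p, hB.symm v q, hB.symm x q, hB.symm z q]
  ring_nf
  simp

end Basics

/-! ### Double extensions and their comparison with the models. -/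

section DoubleExtension

variable {𝔤 : Type*} [LieRing 𝔤] [LieAlgebra ℂ 𝔤] {B : LinearMap.BilinForm ℂ 𝔤}

/-- `(𝔤, B)` is the double extension of the abelian quotient `z^⊥ / ℂ z` by the skew-symmetric map
that `ad d` induces on it. -/
structure IsDoubleExtension (B : LinearMap.BilinForm ℂ 𝔤) (z d : 𝔤) : Prop where
  central : ∀ x : 𝔤, ⁅x, z⁆ = 0
  isotropic : B z z = 0
  pairing : B z d = 1
  isotropic_right : B d d = 0
  lie_eq : ∀ x y : 𝔤, B x z = 0 → B y z = 0 → ⁅x, y⁆ = B ⁅d, x⁆ y • z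

/-- Any `w` differs from a vector of `z^⊥` by `B w z • d`, so `B ⁅x, y⁆ w` is determined by `B ⁅x,
y⁆ d`, which equals `B ⁅d, x⁆ y` by cyclicity. -/
theorem isDoubleExtension_of_forall (hB : IsQuadratic B) {z d : 𝔤} (hz : ∀ x : 𝔤, ⁅x, z⁆ = 0)
    (hzz : B z z = 0) (hzd : B z d = 1) (hdd : B d d = 0)
    (h : ∀ x y w : 𝔤, B x z = 0 → B y z = 0 → B w z = 0 → B ⁅x, y⁆ w = 0) :
    IsDoubleExtension B z d := by
  refine ⟨hz, hzz, hzd, hdd, fun x y hx hy => hB.eq_of_forall fun w => ?_⟩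
  have hdz : B d z = 1 := by rw [hB.symm, hzd]
  have h1 := h x y (w - B w z • d) hx hy (by simp [hdz])
  rw [map_sub, map_smul, sub_eq_zero] at h1
  rw [h1, map_smul, LinearMap.smul_apply, hB.symm z w, smul_eq_mul, smul_eq_mul,
    hB.lie_left_comm d x y, mul_comm]

namespace IsDoubleExtension

variable {z d : 𝔤}

theorem central' (h : IsDoubleExtension B z d) (x : 𝔤) : ⁅z, x⁆ = 0 := by
  rw [← lie_skew, h.central, neg_zero]

theorem smul (h : IsDoubleExtension B z d) {t : ℂ} (ht : t ≠ 0) :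
    IsDoubleExtension B (t • z) (t⁻¹ • d) where
  central x := by rw [lie_smul, h.central, smul_zero]
  isotropic := by simp [h.isotropic]
  pairing := by simp [h.pairing, ht]
  isotropic_right := by simp [h.isotropic_right]
  lie_eq x y hx hy := by
    have hx' : B x z = 0 := by simpa [ht] using hx
    have hy' : B y z = 0 := by simpa [ht] using hy
    rw [h.lie_eq x y hx' hy', smul_lie, map_smul, LinearMap.smul_apply, smul_smul, smul_eq_mul]
    congr 1
    field_simp

theorem lie_add_smul (h : IsDoubleExtension B z d) {x y : 𝔤} (hx : B x z = 0) (hy : B y z = 0)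
    (a b a' b' : ℂ) : ⁅x + a • z + b • d, y + a' • z + b' • d⁆ =
      B ⁅d, x⁆ y • z + b • ⁅d, y⁆ - b' • ⁅d, x⁆ := by
  simp only [add_lie, lie_add, smul_lie, lie_smul, h.central, h.central', h.lie_eq x y hx hy,
    lie_self, ← _root_.lie_skew x d]
  module

/-- A double extension with the structure constants of `Model M` is i-isomorphic to it. -/
theorem iisomorphic (h : IsDoubleExtension B z d) (hB : IsQuadratic B)
    (hdim : Module.finrank ℂ 𝔤 = 6) {z₁ z₂ x₁ x₂ : 𝔤} (hh : IsHyperbolic B z₁ z₂ z x₁ x₂ d)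
    {M : Matrix (Fin 2) (Fin 2) ℂ} (h11 : B ⁅d, z₁⁆ x₁ = M 0 0) (h12 : B ⁅d, z₁⁆ x₂ = M 1 0)
    (h21 : B ⁅d, z₂⁆ x₁ = M 0 1) (h22 : B ⁅d, z₂⁆ x₂ = M 1 1) (hz : B ⁅d, z₁⁆ z₂ = 0)
    (hx : B ⁅d, x₁⁆ x₂ = 0) : IIsomorphic B (Model.form M) := by
  have hh' := hh.flip hB
  have hexp := hh.expand hB hdim
  simp only [IsHyperbolic] at hh
  have hdz (u : 𝔤) : B ⁅d, u⁆ z = 0 := by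
    rw [hB.lie_left_comm, h.central, map_zero, LinearMap.zero_apply]
  have hdd (u : 𝔤) : B ⁅d, u⁆ d = 0 := by
    rw [hB.lie_left_comm, hB.lie_apply_right_self]
  have hs (u : 𝔤) : B ⁅d, u⁆ u = 0 := hB.lie_apply_right_self d u
  have s11 : B ⁅d, x₁⁆ z₁ = -M 0 0 := by rw [hB.lie_skew, h11]
  have s12 : B ⁅d, x₂⁆ z₁ = -M 1 0 := by rw [hB.lie_skew, h12]
  have s21 : B ⁅d, x₁⁆ z₂ = -M 0 1 := by rw [hB.lie_skew, h21]
  have s22 : B ⁅d, x₂⁆ z₂ = -M 1 1 := by rw [hB.lie_skew, h22]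
  have hz' : B ⁅d, z₂⁆ z₁ = 0 := by rw [hB.lie_skew, hz, neg_zero]
  have hx' : B ⁅d, x₂⁆ x₁ = 0 := by rw [hB.lie_skew, hx, neg_zero]
  have e1 : ⁅d, z₁⁆ = M 0 0 • z₁ + M 1 0 • z₂ := by
    rw [hexp ⁅d, z₁⁆]; simp only [hdz, hdd, hs, h11, h12, hz, zero_smul, add_zero]
  have e2 : ⁅d, z₂⁆ = M 0 1 • z₁ + M 1 1 • z₂ := by
    rw [hexp ⁅d, z₂⁆]; simp only [hdz, hdd, hs, h21, h22, hz', zero_smul, add_zero]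
  have e3 : ⁅d, x₁⁆ = -(M 0 0 • x₁) - M 0 1 • x₂ := by
    rw [hexp ⁅d, x₁⁆]; simp only [hdz, hdd, hs, s11, s21, hx]; module
  have e4 : ⁅d, x₂⁆ = -(M 1 0 • x₁) - M 1 1 • x₂ := by
    rw [hexp ⁅d, x₂⁆]; simp only [hdz, hdd, hs, s12, s22, hx']; module
  let f : Model M →ₗ[ℂ] 𝔤 :=
    { toFun := fun u => (u.1 0 • z₁ + u.1 1 • z₂ + u.2 0 • x₁ + u.2 1 • x₂) + u.1 2 • z + u.2 2 • d
      map_add' := fun u v => by simp only [Model.add_fst, Model.add_snd]; module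
      map_smul' := fun t u => by
        simp only [Model.smul_fst, Model.smul_snd, RingHom.id_apply]; module }
  have hf (u : Model M) : f u =
    (u.1 0 • z₁ + u.1 1 • z₂ + u.2 0 • x₁ + u.2 1 • x₂) + u.1 2 • z + u.2 2 • d := rfl
  have hisom (u v : Model M) : B (f u) (f v) = Model.form M u v := by
    rw [hf, hf, Model.form_apply, Fin.sum_univ_three]
    simp only [map_add, map_smul, LinearMap.add_apply, LinearMap.smul_apply, smul_eq_mul, hh, hh']
    ring
  have hlie (u v : Model M) : f ⁅u, v⁆ = ⁅f u, f v⁆ := by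
    have hp (w : Model M) : B (w.1 0 • z₁ + w.1 1 • z₂ + w.2 0 • x₁ + w.2 1 • x₂) z = 0 := by
      simp [hh, hh']
    have hD (w : Model M) : ⁅d, w.1 0 • z₁ + w.1 1 • z₂ + w.2 0 • x₁ + w.2 1 • x₂⁆ =
        (M 0 0 * w.1 0 + M 0 1 * w.1 1) • z₁ + (M 1 0 * w.1 0 + M 1 1 * w.1 1) • z₂
        - (M 0 0 * w.2 0 + M 1 0 * w.2 1) • x₁ - (M 0 1 * w.2 0 + M 1 1 * w.2 1) • x₂ := by
      simp only [lie_add, lie_smul, e1, e2, e3, e4]; module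
    rw [hf u, hf v, h.lie_add_smul (hp u) (hp v), hD, hD, hf]
    simp only [map_add, map_sub, map_smul, LinearMap.add_apply, LinearMap.sub_apply,
      LinearMap.smul_apply, smul_eq_mul, hh, hh', Model.lie_fst_zero, Model.lie_fst_one,
      Model.lie_fst_two, Model.lie_snd_zero, Model.lie_snd_one, Model.lie_snd_two]
    module
  let A : Model M ≃ₗ[ℂ] 𝔤 := LinearEquiv.ofBijective f ⟨by
      refine (injective_iff_map_eq_zero f).2 fun u hu => (Model.form_isQuadratic M).nondegenerate u
        fun v => ?_
      rw [← hisom, hu, map_zero, LinearMap.zero_apply], fun u => by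
      let w : Model M := (![B u x₁, B u x₂, B u d], ![B u z₁, B u z₂, B u z])
      refine ⟨w, ?_⟩
      change B u x₁ • z₁ + B u x₂ • z₂ + B u z₁ • x₁ + B u z₂ • x₂ + B u d • z + B u z • d = u
      conv_rhs => rw [hexp u]
      abel⟩
  let A' : Model M ≃ₗ⁅ℂ⁆ 𝔤 := { A with map_lie' := fun {u v} => hlie u v }
  refine ⟨A'.symm, fun x y => ?_⟩
  rw [← hisom]
  exact congrArg₂ (fun a b => B a b) (A'.apply_symm_apply x) (A'.apply_symm_apply y)

end IsDoubleExtension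

end DoubleExtension

/-! ### Normal forms of the skew map `ad d`. -/

section NormalForm

variable {𝔤 : Type*} [LieRing 𝔤] [LieAlgebra ℂ 𝔤] {B : LinearMap.BilinForm ℂ 𝔤}

namespace IsDoubleExtension

variable {z d v p x q : 𝔤}

/-- The algebra is `z^⊥ ⊕ ℂ d`, and brackets inside `z^⊥` are governed by `ad d`. Together with
isotropy of the center, this rules out non-isotropic vectors of `z^⊥` killed by `ad d`. -/
theorem central_of_lie_eq_zero (h : IsDoubleExtension B z d) (hB : IsQuadratic B) {y : 𝔤}
    (hy : B y z = 0) (hdy : ⁅d, y⁆ = 0) (u : 𝔤) : ⁅u, y⁆ = 0 := by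
  have hdz : B d z = 1 := by rw [hB.symm, h.pairing]
  have h1 := h.lie_eq y (u - B u z • d) hy (by simp [hdz])
  rw [hdy, map_zero, LinearMap.zero_apply, zero_smul, lie_sub, lie_smul, ← lie_skew y d, hdy,
    neg_zero, smul_zero, sub_zero] at h1
  rw [← lie_skew, h1, neg_zero]

theorem lie_expand (h : IsDoubleExtension B z d) (hB : IsQuadratic B)
    (hdim : Module.finrank ℂ 𝔤 = 6) (hh : IsHyperbolic B v p z x q d) (u : 𝔤) :
    ⁅d, u⁆ = B ⁅d, u⁆ x • v + B ⁅d, u⁆ q • p + B ⁅d, u⁆ v • x + B ⁅d, u⁆ p • q := by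
  conv_lhs => rw [hh.expand hB hdim ⁅d, u⁆]
  have hdz : B ⁅d, u⁆ z = 0 := by
    rw [hB.lie_left_comm, h.central, map_zero, LinearMap.zero_apply]
  have hdd : B ⁅d, u⁆ d = 0 := by
    rw [hB.lie_left_comm, hB.lie_apply_right_self]
  simp [hdz, hdd]

/-- By skewness `ad d` preserves `v^⊥`, which removes the `x` component; on the hyperbolic plane
spanned by `p, q` modulo `v` a skew map is diagonal with opposite entries. -/
theorem lie_of_eigenvector (h : IsDoubleExtension B z d) (hB : IsQuadratic B)
    (hdim : Module.finrank ℂ 𝔤 = 6) (hh : IsHyperbolic B v p z x q d) {a : ℂ}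
    (hv : ⁅d, v⁆ = a • v) :
    ⁅d, p⁆ = B ⁅d, p⁆ q • p + B ⁅d, p⁆ x • v ∧ ⁅d, q⁆ = -(B ⁅d, p⁆ q) • q + B ⁅d, q⁆ x • v := by
  have hh' := hh.flip hB
  have hh'' := hh
  simp only [IsHyperbolic] at hh
  have h1 : B ⁅d, p⁆ v = 0 := by rw [hB.lie_skew, hv]; simp [hh]
  have h2 : B ⁅d, q⁆ v = 0 := by rw [hB.lie_skew, hv]; simp [hh]
  constructor
  · conv_lhs => rw [h.lie_expand hB hdim hh'' p]
    simp only [h1, hB.lie_apply_right_self]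
    module
  · conv_lhs => rw [h.lie_expand hB hdim hh'' q]
    simp only [h2, hB.lie_apply_right_self, hB.lie_skew d q p]
    module

/-- Here `ad d` acts on the span of `v, p` by the triangular matrix with diagonal `1, c` and corner
`m`, and `q` is an eigenvector. For `c ≠ 1` a shear removes `m`; for `c = 1` a nonzero `m` is scaled
to 1. -/
theorem iisomorphic_of_isHyperbolic (h : IsDoubleExtension B z d) (hB : IsQuadratic B)
    (hdim : Module.finrank ℂ 𝔤 = 6) (hc : ∀ y : 𝔤, (∀ u : 𝔤, ⁅u, y⁆ = 0) → B y y = 0)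
    (hh : IsHyperbolic B v p z x q d) (hv : ⁅d, v⁆ = v) (hxq : B ⁅d, x⁆ q = 0) :
    (∃ c : ℂ, c ≠ 0 ∧ IIsomorphic B (B62 c)) ∨ IIsomorphic B B63 := by
  obtain ⟨hp, hq⟩ := h.lie_of_eigenvector hB hdim hh (a := 1) (by rw [hv, one_smul])
  rw [hB.lie_skew d q x, hxq] at hq
  set c := B ⁅d, p⁆ q with hcdef
  set m := B ⁅d, p⁆ x with hmdef
  have hf := hh.flip hB
  have hh' := hh
  simp only [IsHyperbolic] at hh'
  have hc0 : c ≠ 0 := by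
    intro hc0
    -- If `c = 0` this vector is central, yet its square is 2.
    have h1 := hc (p - m • v + q) (h.central_of_lie_eq_zero hB (by simp [hh', hf])
      (by simp [hp, hq, hv, hc0]))
    simp [hh', hf] at h1
  by_cases hc1 : c = 1
  · by_cases hm : m = 0
    · refine Or.inl ⟨c, hc0, h.iisomorphic hB hdim hh ?_ ?_ ?_ ?_ ?_ hxq⟩ <;>
        simp [hp, hv, hh', hc1, hm]
    · refine Or.inr (h.iisomorphic hB hdim (hh.smul_fst hm) ?_ ?_ ?_ ?_ ?_ ?_)
      · simp [hv, hh', hm]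
      · simp [hv, hh']
      · simp [hp, hh', hm]
      · simp [hp, hh', hc1]
      · simp [hv, hh']
      · simp [hxq]
  · have hc1' : c - 1 ≠ 0 := sub_ne_zero.2 hc1
    refine Or.inl ⟨c, hc0, h.iisomorphic hB hdim (hh.shear hB (m / (c - 1)) 0) ?_ ?_ ?_ ?_ ?_ ?_⟩
    · simp [hv, hh']
    · simp [hv, hh']
    · simp [hv, hp, hh']
      field_simp
      ring
    · simp [hv, hp, hh']
    · simp [hv, hh']
    · simp [hxq, hh', hq]

theorem iisomorphic_of_eigenvector (h : IsDoubleExtension B z d) (hB : IsQuadratic B)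
    (hdim : Module.finrank ℂ 𝔤 = 6) (hc : ∀ y : 𝔤, (∀ u : 𝔤, ⁅u, y⁆ = 0) → B y y = 0)
    (hv0 : v ≠ 0) (hv : ⁅d, v⁆ = v) :
    (∃ c : ℂ, c ≠ 0 ∧ IIsomorphic B (B62 c)) ∨ IIsomorphic B B63 := by
  have hvv : B v v = 0 := by
    have := hB.lie_apply_right_self d v
    rwa [hv] at this
  have hvz : B v z = 0 := by
    rw [← hv, hB.lie_left_comm, h.central, map_zero, LinearMap.zero_apply]
  have hvd : B v d = 0 := by
    rw [← hv, hB.lie_left_comm, hB.lie_apply_right_self]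
  obtain ⟨p, x, q, hh, hcq⟩ : ∃ p x q, IsHyperbolic B v p z x q d ∧ B ⁅d, p⁆ q ≠ -1 := by
    obtain ⟨p, x, q, hh⟩ := exists_isHyperbolic hB hdim h.isotropic h.pairing h.isotropic_right
      hv0 hvv hvz hvd
    -- Exchanging `p` and `q` changes the sign of `c`, so `1 + c` may be assumed invertible.
    by_cases hcq : B ⁅d, p⁆ q = -1
    · refine ⟨q, x, p, hh.swap hB, ?_⟩
      rw [hB.lie_skew, hcq]
      norm_num
    · exact ⟨p, x, q, hh, hcq⟩
  obtain ⟨hp, hq⟩ := h.lie_of_eigenvector hB hdim hh (a := 1) (by rw [hv, one_smul])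
  have hcq' : 1 + B ⁅d, p⁆ q ≠ 0 := fun h0 => hcq (by linear_combination h0)
  -- With shear parameter `s`, the pairing of `⁅d, x⁆` with `q` becomes `-B ⁅d, q⁆ x - s (1 + c)`;
  -- this `s` makes it vanish.
  refine h.iisomorphic_of_isHyperbolic hB hdim hc
    (hh.shear hB 0 (-B ⁅d, q⁆ x / (1 + B ⁅d, p⁆ q))) hv ?_
  have hf := hh.flip hB
  simp only [IsHyperbolic] at hh
  have h1 : B ⁅d, x⁆ q = -B ⁅d, q⁆ x := hB.lie_skew _ _ _
  have h2 : B ⁅d, x⁆ v = -1 := by rw [hB.lie_skew, hv, hh.2.2.1.1]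
  have h3 : B ⁅d, p⁆ v = 0 := by rw [hB.lie_skew, hv, hh.1.2.1, neg_zero]
  simp [h1, h2, h3]
  field_simp
  ring

theorem iisomorphic_of_kernel (h : IsDoubleExtension B z d) (hB : IsQuadratic B)
    (hdim : Module.finrank ℂ 𝔤 = 6) (hc : ∀ y : 𝔤, (∀ u : 𝔤, ⁅u, y⁆ = 0) → B y y = 0)
    (hd : ∀ (a : ℂ) (u : 𝔤), ⁅d, u⁆ = a • u → u ≠ 0 → a = 0)
    (hv0 : v ≠ 0) (hvz : B v z = 0) (hvd : B v d = 0) (hv : ⁅d, v⁆ = 0) :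
    IIsomorphic B B61 := by
  have hvv : B v v = 0 := hc v (h.central_of_lie_eq_zero hB hvz hv)
  obtain ⟨p, x, q, hh, hm'⟩ :
      ∃ p x q, IsHyperbolic B v p z x q d ∧ ⁅d, q⁆ = 0 := by
    obtain ⟨p, x, q, hh⟩ := exists_isHyperbolic hB hdim h.isotropic h.pairing h.isotropic_right
      hv0 hvv hvz hvd
    obtain ⟨hp, hq⟩ := h.lie_of_eigenvector hB hdim hh (a := 0) (by rw [hv, zero_smul])
    have hf := hh.flip hB
    have hh' := hh
    simp only [IsHyperbolic] at hh'
    set c := B ⁅d, p⁆ q with hcdef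
    set m := B ⁅d, p⁆ x with hmdef
    set m' := B ⁅d, q⁆ x with hm'def
    have hc0 : c = 0 := by
      by_contra hc0
      -- This would be an eigenvector for the nonzero eigenvalue `c`.
      refine hc0 (hd c (p + (m / c) • v) ?_ fun h0 => ?_)
      · rw [lie_add, lie_smul, hv, hp, smul_add, smul_smul, mul_div_cancel₀ _ hc0]
        simp
      · have h1 : B (p + (m / c) • v) q = 1 := by simp [hh']
        rw [h0] at h1
        simp at h1
    -- Now `⁅d, p⁆ = m • v` and `⁅d, q⁆ = m' • v`, so this combination is central; its square is `-2
    -- m m'`.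
    have h1 := hc (m' • p - m • q) (h.central_of_lie_eq_zero hB (by simp [hh', hf])
      (by simp [hp, hq, hc0, smul_smul, mul_comm]))
    simp [hh', hf] at h1
    have h2 : m = 0 ∨ m' = 0 := by
      have : m * m' = 0 := by linear_combination (-1 / 2 : ℂ) * h1
      simpa using this
    rcases h2 with h2 | h2
    · exact ⟨q, x, p, hh.swap hB, by rw [hp, hc0, h2]; simp⟩
    · exact ⟨p, x, q, hh, by rw [hq, hc0, h2]; simp⟩
  have hf := hh.flip hB
  have hh' := hh
  simp only [IsHyperbolic] at hh'
  obtain ⟨hp, -⟩ := h.lie_of_eigenvector hB hdim hh (a := 0) (by rw [hv, zero_smul])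
  have hc0 : B ⁅d, p⁆ q = 0 := by rw [hB.lie_skew, hm']; simp
  rw [hc0, zero_smul, zero_add] at hp
  set m := B ⁅d, p⁆ x with hmdef
  have hm : m ≠ 0 := by
    intro hm
    have h1 := hc (p + q) (h.central_of_lie_eq_zero hB (by simp [hh', hf])
      (by simp [hp, hm, hm']))
    simp [hh', hf] at h1
  refine h.iisomorphic hB hdim (hh.smul_fst hm) ?_ ?_ ?_ ?_ ?_ ?_
  · simp [hv]
  · simp [hv]
  · simp [hp, hh', hm]
  · simp [hp, hh']
  · simp [hv]
  · rw [hB.lie_skew, hm']; simp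

/-- The six-dimensional double extensions whose center is totally isotropic. -/
theorem classification (h : IsDoubleExtension B z d) (hB : IsQuadratic B)
    (hdim : Module.finrank ℂ 𝔤 = 6) (hc : ∀ y : 𝔤, (∀ u : 𝔤, ⁅u, y⁆ = 0) → B y y = 0) :
    IIsomorphic B B61 ∨ (∃ c : ℂ, c ≠ 0 ∧ IIsomorphic B (B62 c)) ∨ IIsomorphic B B63 := by
  have : FiniteDimensional ℂ 𝔤 := Module.finite_of_finrank_eq_succ hdim
  by_cases hd : ∀ (a : ℂ) (u : 𝔤), ⁅d, u⁆ = a • u → u ≠ 0 → a = 0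
  · refine Or.inl ?_
    have hU : Set.MapsTo (LieAlgebra.ad ℂ 𝔤 d) (perp B ![z, d]) (perp B ![z, d]) := by
      intro u _
      rw [SetLike.mem_coe, mem_perp, LieAlgebra.ad_apply]
      refine Fin.forall_fin_two.2 ⟨?_, ?_⟩
      · change B ⁅d, u⁆ z = 0
        rw [hB.lie_left_comm, h.central, map_zero, LinearMap.zero_apply]
      · change B ⁅d, u⁆ d = 0
        rw [hB.lie_left_comm, hB.lie_apply_right_self]
    have hrank := finrank_le_finrank_perp_add (B := B) ![z, d]
    have : Nontrivial (perp B ![z, d]) := Module.nontrivial_of_finrank_pos (R := ℂ) (by omega)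
    obtain ⟨a, ha⟩ := Module.End.exists_eigenvalue ((LieAlgebra.ad ℂ 𝔤 d).restrict hU)
    obtain ⟨⟨v, hvU⟩, hv⟩ := ha.exists_hasEigenvector
    have hv0 : v ≠ 0 := by simpa using hv.2
    have hva : ⁅d, v⁆ = a • v := congrArg Subtype.val hv.apply_eq_smul
    rw [mem_perp] at hvU
    refine h.iisomorphic_of_kernel hB hdim hc hd hv0 (hvU 0) (hvU 1) ?_
    rw [hva, hd a v hva hv0, zero_smul]
  · push Not at hd
    obtain ⟨a, v, hv, hv0, ha⟩ := hd
    exact Or.inr <| (h.smul ha).iisomorphic_of_eigenvector hB hdim hc hv0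
      (by rw [smul_lie, hv, inv_smul_smul₀ ha])

end IsDoubleExtension

end NormalForm

/-! ### The center, and Lie's theorem. -/

section Center

variable {𝔤 : Type*} [LieRing 𝔤] [LieAlgebra ℂ 𝔤] {B : LinearMap.BilinForm ℂ 𝔤}

/-- In an indecomposable quadratic Lie algebra of dimension at least two the central vectors are
isotropic. -/
theorem isotropic_of_central [FiniteDimensional ℂ 𝔤] (hB : IsQuadratic B)
    (hind : IsIndecomposable B) (hdim : 1 < Module.finrank ℂ 𝔤) (y : 𝔤)
    (hy : ∀ u : 𝔤, ⁅u, y⁆ = 0) : B y y = 0 := by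
  by_contra hyy
  let I : LieIdeal ℂ 𝔤 :=
    { Submodule.span ℂ {y} with
      lie_mem := fun {u w} hw => by
        obtain ⟨a, rfl⟩ := Submodule.mem_span_singleton.1 hw
        change ⁅u, a • y⁆ ∈ Submodule.span ℂ {y}
        rw [lie_smul, hy, smul_zero]
        exact Submodule.zero_mem _ }
  let J : LieIdeal ℂ 𝔤 :=
    { perp B ![y] with
      lie_mem := fun {u w} _ => by
        change ⁅u, w⁆ ∈ perp B ![y]
        rw [mem_perp, Fin.forall_fin_one]
        change B ⁅u, w⁆ y = 0
        rw [hB.lie_left_comm, hy, map_zero, LinearMap.zero_apply] }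
  have hI (w : 𝔤) : w ∈ I ↔ ∃ a : ℂ, a • y = w := Submodule.mem_span_singleton
  have hJ (w : 𝔤) : w ∈ J ↔ B w y = 0 := by
    change w ∈ perp B ![y] ↔ _
    rw [mem_perp, Fin.forall_fin_one]
    rfl
  have hcompl : IsCompl I J := by
    constructor
    · rw [disjoint_iff, LieSubmodule.eq_bot_iff]
      intro w hw
      rw [LieSubmodule.mem_inf, hI, hJ] at hw
      obtain ⟨⟨a, rfl⟩, h⟩ := hw
      rw [map_smul, LinearMap.smul_apply, smul_eq_mul, mul_eq_zero, or_iff_left hyy] at h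
      rw [h, zero_smul]
    · rw [codisjoint_iff, eq_top_iff]
      intro w _
      rw [LieSubmodule.mem_sup]
      refine ⟨(B w y / B y y) • y, (hI _).2 ⟨_, rfl⟩, w - (B w y / B y y) • y, (hJ _).2 ?_, ?_⟩
      · simp [hyy]
      · abel
  rcases hind I J hcompl fun x hx w hw => by
      obtain ⟨a, rfl⟩ := (hI _).1 hx
      rw [map_smul, LinearMap.smul_apply, hB.symm, (hJ w).1 hw, smul_zero] with h | h
  · have : y ∈ I := (hI y).2 ⟨1, one_smul _ _⟩
    rw [h, LieSubmodule.mem_bot] at this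
    rw [this] at hyy
    simp at hyy
  · have h1 := finrank_le_finrank_perp_add (B := B) ![y]
    have h2 : perp B ![y] = ⊥ := by
      rw [eq_bot_iff]
      intro w hw
      have : w ∈ J := hw
      rwa [h, LieSubmodule.mem_bot] at this
    rw [h2, finrank_bot] at h1
    omega

/-- A vector that is not in the derived ideal is not orthogonal to the center. -/
theorem exists_central_of_notMem [FiniteDimensional ℂ 𝔤] (hB : IsQuadratic B) {x : 𝔤}
    (hx : x ∉ Submodule.span ℂ {w : 𝔤 | ∃ a b : 𝔤, ⁅a, b⁆ = w}) :
    ∃ y : 𝔤, (∀ u : 𝔤, ⁅u, y⁆ = 0) ∧ B y x ≠ 0 := by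
  obtain ⟨f, hfx, hf⟩ := Submodule.exists_le_ker_of_notMem hx
  obtain ⟨y, hy⟩ := hB.exists_forall_apply_eq f
  refine ⟨y, fun u => ?_, by rwa [hy]⟩
  rw [← lie_skew, neg_eq_zero]
  refine hB.nondegenerate _ fun w => ?_
  rw [hB.invariant, hy]
  exact hf (Submodule.subset_span ⟨u, w, rfl⟩)

theorem exists_central_ne_zero [FiniteDimensional ℂ 𝔤] [Nontrivial 𝔤] [LieAlgebra.IsSolvable 𝔤]
    (hB : IsQuadratic B) : ∃ y : 𝔤, (∀ u : 𝔤, ⁅u, y⁆ = 0) ∧ y ≠ 0 := by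
  obtain ⟨x, hx⟩ : ∃ x : 𝔤, x ∉ Submodule.span ℂ {w : 𝔤 | ∃ a b : 𝔤, ⁅a, b⁆ = w} := by
    by_contra! h
    refine (LieAlgebra.derivedSeries_lt_top_of_solvable ℂ 𝔤).ne (eq_top_iff.2 fun x _ => ?_)
    have h1 : x ∈ (⁅(⊤ : LieIdeal ℂ 𝔤), (⊤ : LieIdeal ℂ 𝔤)⁆ : LieIdeal ℂ 𝔤).toSubmodule := by
      rw [LieSubmodule.lieIdeal_oper_eq_linear_span']
      simpa using h x
    simpa using h1
  obtain ⟨y, hy, hyx⟩ := exists_central_of_notMem hB hx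
  exact ⟨y, hy, fun h => hyx (by rw [h, map_zero, LinearMap.zero_apply])⟩

/-- Lie's theorem for the quotient of two ideals. -/
theorem exists_weight_vector [FiniteDimensional ℂ 𝔤] [LieAlgebra.IsSolvable 𝔤]
    (J N : LieIdeal ℂ 𝔤) (h : ¬ N ≤ J) :
    ∃ v ∈ N, v ∉ J ∧ ∃ χ : 𝔤 → ℂ, ∀ u : 𝔤, ⁅u, v⁆ - χ u • v ∈ J := by
  let V : LieSubmodule ℂ 𝔤 (𝔤 ⧸ J) := LieSubmodule.map (LieSubmodule.Quotient.mk' J) N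
  have hV : Nontrivial V := by
    obtain ⟨n, hn, hnJ⟩ := SetLike.not_le_iff_exists.1 h
    refine nontrivial_of_ne (⟨LieSubmodule.Quotient.mk' J n, LieSubmodule.mem_map_of_mem hn⟩ : V) 0
      fun h0 => hnJ ?_
    have h1 := congrArg Subtype.val h0
    exact LieSubmodule.Quotient.mk_eq_zero'.1 h1
  obtain ⟨χ, hχ⟩ := LieModule.exists_nontrivial_weightSpace_of_isSolvable ℂ 𝔤 V
  obtain ⟨⟨⟨w, hw⟩, hwχ⟩, hw0⟩ := exists_ne (0 : LieModule.weightSpace V χ)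
  obtain ⟨v, hv, rfl⟩ := (LieSubmodule.mem_map _).1 hw
  rw [LieModule.mem_weightSpace] at hwχ
  refine ⟨v, hv, fun hvJ => hw0 ?_, χ, fun u => ?_⟩
  · refine Subtype.ext (Subtype.ext ?_)
    exact LieSubmodule.Quotient.mk_eq_zero'.2 hvJ
  · have h1 := congrArg Subtype.val (hwχ u)
    refine LieSubmodule.Quotient.mk_eq_zero'.1 ?_
    change LieSubmodule.Quotient.mk' J (⁅u, v⁆ - χ u • v) = 0
    rw [map_sub, map_smul, LieModuleHom.map_lie, sub_eq_zero]
    exact h1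

/-- The derived algebra has weight zero. -/
theorem lie_mem_of_weight {J : LieIdeal ℂ 𝔤} {v : 𝔤} {χ : 𝔤 → ℂ}
    (h : ∀ u : 𝔤, ⁅u, v⁆ - χ u • v ∈ J) {x : 𝔤}
    (hx : x ∈ Submodule.span ℂ {w : 𝔤 | ∃ a b : 𝔤, ⁅a, b⁆ = w}) : ⁅x, v⁆ ∈ J := by
  induction hx using Submodule.span_induction with
  | mem w hw =>
    obtain ⟨a, b, rfl⟩ := hw
    -- Modulo `J`, `a` and `b` act on `v` by scalars, which commute.
    have h1 := J.sub_mem (J.sub_mem (LieSubmodule.lie_mem (x := a) J (h b))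
      (LieSubmodule.lie_mem (x := b) J (h a)))
      (J.sub_mem (J.smul_mem (χ a) (h b)) (J.smul_mem (χ b) (h a)))
    rw [lie_sub, lie_sub, lie_smul, lie_smul] at h1
    rw [lie_lie]
    have h2 : ⁅a, ⁅b, v⁆⁆ - ⁅b, ⁅a, v⁆⁆ = ⁅a, ⁅b, v⁆⁆ - χ b • ⁅a, v⁆ - (⁅b, ⁅a, v⁆⁆ - χ a • ⁅b, v⁆) -
        (χ a • (⁅b, v⁆ - χ b • v) - χ b • (⁅a, v⁆ - χ a • v)) := by
      module
    rw [h2]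
    exact h1
  | zero => rw [zero_lie]; exact J.zero_mem
  | add a b _ _ ha hb => rw [add_lie]; exact J.add_mem ha hb
  | smul t a _ ha => rw [smul_lie]; exact J.smul_mem t ha

end Center

/-! ### Finding `z` with `z^⊥ / ℂ z` abelian. -/

section Existence

variable {𝔤 : Type*} [LieRing 𝔤] [LieAlgebra ℂ 𝔤] {B : LinearMap.BilinForm ℂ 𝔤}

/-- On the hyperplane `z^⊥` the alternating form `B ⁅x, y⁆ w` vanishes as soon as its kernel contains
three independent vectors. -/
theorem lie_apply_eq_zero_of_linearIndependent (hB : IsQuadratic B)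
    (hdim : Module.finrank ℂ 𝔤 = 6) {z v₁ v₂ : 𝔤} (hz : ∀ u : 𝔤, ⁅u, z⁆ = 0)
    (hli : LinearIndependent ℂ ![z, v₁, v₂]) (hzz : B z z = 0) (hv₁ : B v₁ z = 0)
    (hv₂ : B v₂ z = 0) (h₁ : ∀ x y : 𝔤, B x z = 0 → B y z = 0 → B ⁅v₁, x⁆ y = 0)
    (h₂ : ∀ x y : 𝔤, B x z = 0 → B y z = 0 → B ⁅v₂, x⁆ y = 0) (x y w : 𝔤) (hx : B x z = 0)
    (hy : B y z = 0) (hw : B w z = 0) : B ⁅x, y⁆ w = 0 := by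
  have : FiniteDimensional ℂ 𝔤 := Module.finite_of_finrank_eq_succ hdim
  have hz0 : z ≠ 0 := hli.ne_zero 0
  obtain ⟨d, hzd⟩ := hB.exists_apply_eq_one hz0
  have hdz : B d z = 1 := by rw [hB.symm, hzd]
  -- Seven vectors in dimension six. Pairing the relation with `z` removes `d`; inserting it into
  -- the trilinear form gives `g i * B ⁅x, y⁆ w = 0` for the coefficients of `x, y, w`. If the form
  -- were nonzero, a relation among `z, v₁, v₂` would remain.
  have hdep : ¬ LinearIndependent ℂ ![x, y, w, z, v₁, v₂, d] := fun h => by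
    have := h.fintype_card_le_finrank
    simp [hdim] at this
  rw [Fintype.not_linearIndependent_iff] at hdep
  obtain ⟨g, hg, i, hi⟩ := hdep
  simp only [Fin.sum_univ_seven] at hg
  change g 0 • x + g 1 • y + g 2 • w + g 3 • z + g 4 • v₁ + g 5 • v₂ + g 6 • d = 0 at hg
  have h6 : g 6 = 0 := by
    have := congrArg (fun u => B u z) hg
    simpa [hx, hy, hw, hzz, hv₁, hv₂, hdz] using this
  have hI (s t : 𝔤) (hs : B s z = 0) (ht : B t z = 0) :
      g 0 * B ⁅x, s⁆ t + g 1 * B ⁅y, s⁆ t + g 2 * B ⁅w, s⁆ t = 0 := by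
    have := congrArg (fun u => B ⁅u, s⁆ t) hg
    simpa [add_lie, h₁ s t hs ht, h₂ s t hs ht, h6, ← lie_skew z s, hz] using this
  have e0 : g 0 * B ⁅x, y⁆ w = 0 := by
    simpa [hB.lie_apply_right_self, hB.lie_left_comm w y w] using hI y w hy hw
  have e1 : g 1 * B ⁅x, y⁆ w = 0 := by
    have := hI w x hw hx
    rw [hB.lie_left_comm x w x, hB.lie_apply_right_self, lie_self] at this
    simpa [← hB.lie_left_comm x y w] using this
  have e2 : g 2 * B ⁅x, y⁆ w = 0 := by
    have := hI x y hx hy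
    rw [lie_self, hB.lie_left_comm y x y, hB.lie_apply_right_self] at this
    simpa [hB.lie_left_comm w x y] using this
  by_contra hne
  rw [mul_eq_zero, or_iff_left hne] at e0 e1 e2
  rw [e0, e1, e2, h6] at hg
  have h3 := Fintype.linearIndependent_iff.1 hli ![g 3, g 4, g 5] (by
    simpa [Fin.sum_univ_three] using hg)
  have h30 : g 3 = 0 := h3 0
  have h31 : g 4 = 0 := h3 1
  have h32 : g 5 = 0 := h3 2
  fin_cases i <;> simp_all

/-- If the center is one-dimensional then `z^⊥ / ℂ z` is abelian. -/
theorem lie_apply_eq_zero_of_center_le (hB : IsQuadratic B) [LieAlgebra.IsSolvable 𝔤]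
    (hdim : Module.finrank ℂ 𝔤 = 6) {z : 𝔤} (hz : ∀ u : 𝔤, ⁅u, z⁆ = 0) (hz0 : z ≠ 0)
    (hzz : B z z = 0) (hc : ∀ y : 𝔤, (∀ u : 𝔤, ⁅u, y⁆ = 0) → ∃ t : ℂ, y = t • z) (x y w : 𝔤)
    (hx : B x z = 0) (hy : B y z = 0) (hw : B w z = 0) : B ⁅x, y⁆ w = 0 := by
  have : FiniteDimensional ℂ 𝔤 := Module.finite_of_finrank_eq_succ hdim
  -- As the center is `ℂ z`, all of `z^⊥` lies in the derived algebra, hence acts with weight zero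
  -- below.
  have hder (u : 𝔤) (hu : B u z = 0) : u ∈ Submodule.span ℂ {w : 𝔤 | ∃ a b : 𝔤, ⁅a, b⁆ = w} := by
    by_contra h
    obtain ⟨y, hy, hyu⟩ := exists_central_of_notMem hB h
    obtain ⟨t, rfl⟩ := hc y hy
    rw [map_smul, LinearMap.smul_apply, hB.symm, hu, smul_zero] at hyu
    exact hyu rfl
  have hlt {n : ℕ} (hn : n < 3) (s : Fin n → 𝔤) : ¬ perp B s ≤ Submodule.span ℂ (Set.range s) := by
    intro h
    have h1 := finrank_le_finrank_perp_add (B := B) s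
    have h2 := Submodule.finrank_mono h
    have h3 := finrank_range_le_card (R := ℂ) s
    rw [Set.finrank, Fintype.card_fin] at h3
    omega
  have hperp {n : ℕ} (s : Fin n → 𝔤) (u : 𝔤) (hu : u ∈ perp B s) (t : 𝔤)
      (ht : t ∈ Submodule.span ℂ (Set.range s)) : B u t = 0 := by
    have : Submodule.span ℂ (Set.range s) ≤ LinearMap.ker (B u) := by
      rw [Submodule.span_le]
      rintro _ ⟨i, rfl⟩
      exact mem_perp.1 hu i
    exact this ht
  -- The span of `s` is an ideal, hence so is its orthogonal, of dimension at least `6 - n > n`;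
  -- Lie's theorem gives a weight vector of the latter outside the former.
  have hstep {n : ℕ} (hn : n < 3) (s : Fin n → 𝔤)
      (hs : ∀ (u : 𝔤) (i : Fin n), ⁅u, s i⁆ ∈ Submodule.span ℂ (Set.range s)) :
      ∃ v ∈ perp B s, v ∉ Submodule.span ℂ (Set.range s) ∧
        (∀ u : 𝔤, ∃ a : ℂ, ⁅u, v⁆ - a • v ∈ Submodule.span ℂ (Set.range s)) ∧
        ∀ u : 𝔤, B u z = 0 → ⁅u, v⁆ ∈ Submodule.span ℂ (Set.range s) := by
    let J : LieIdeal ℂ 𝔤 :=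
      { Submodule.span ℂ (Set.range s) with
        lie_mem := fun {u w} hw => by
          have : Submodule.span ℂ (Set.range s) ≤
              (Submodule.span ℂ (Set.range s)).comap (LieAlgebra.ad ℂ 𝔤 u) := by
            rw [Submodule.span_le]
            rintro _ ⟨i, rfl⟩
            exact hs u i
          exact this hw }
    let N : LieIdeal ℂ 𝔤 :=
      { perp B s with
        lie_mem := fun {u w} hw => by
          change ⁅u, w⁆ ∈ perp B s
          rw [mem_perp]
          intro i
          rw [← lie_skew, map_neg, LinearMap.neg_apply, hB.invariant, hperp s w hw _ (hs u i),
            neg_zero] }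
    obtain ⟨v, hvN, hvJ, χ, hχ⟩ := exists_weight_vector J N (hlt hn s)
    exact ⟨v, hvN, hvJ, fun u => ⟨χ u, hχ u⟩, fun u hu => lie_mem_of_weight hχ (hder u hu)⟩
  obtain ⟨v₁, hv₁, hv₁z, hχ₁, hd₁⟩ := hstep (by norm_num) ![z] (fun u i => by
    fin_cases i
    simp [hz])
  have hr1 : Set.range ![z] = {z} := by simp
  have hr2 : Set.range ![z, v₁] = {z, v₁} := by simp [Set.pair_comm]
  obtain ⟨v₂, hv₂, hv₂z, -, hd₂⟩ := hstep (by norm_num) ![z, v₁] (fun u i => by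
    fin_cases i
    · simp [hz]
    · obtain ⟨a, ha⟩ := hχ₁ u
      rw [hr1] at ha
      rw [hr2]
      change ⁅u, v₁⁆ ∈ _
      have := Submodule.add_mem _ (Submodule.span_mono (by simp) ha)
        (Submodule.smul_mem (Submodule.span ℂ {z, v₁}) a
          (Submodule.subset_span (show v₁ ∈ ({z, v₁} : Set 𝔤) by simp)))
      simpa using this)
  have hli : LinearIndependent ℂ ![z, v₁, v₂] := by
    have h1 : LinearIndependent ℂ ![z] := by simpa using hz0
    have h2 : LinearIndependent ℂ ![z, v₁] := by
      have h3 : Fin.snoc (α := fun _ => 𝔤) ![z] v₁ = ![z, v₁] := by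
        ext i; fin_cases i <;> rfl
      rw [← h3]
      exact linearIndependent_finSnoc.2 ⟨h1, hv₁z⟩
    have h3 : Fin.snoc (α := fun _ => 𝔤) ![z, v₁] v₂ = ![z, v₁, v₂] := by
      ext i; fin_cases i <;> rfl
    rw [← h3]
    exact linearIndependent_finSnoc.2 ⟨h2, hv₂z⟩
  have hv₁0 : B v₁ z = 0 := mem_perp.1 hv₁ 0
  have hv₂0 : B v₂ z = 0 := mem_perp.1 hv₂ 0
  refine lie_apply_eq_zero_of_linearIndependent hB hdim hz hli hzz hv₁0 hv₂0
    (fun s t hs ht => ?_) (fun s t hs ht => ?_) x y w hx hy hw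
  · rw [← lie_skew, map_neg, LinearMap.neg_apply, neg_eq_zero, hB.symm]
    refine hperp ![z] t ?_ _ (hd₁ s hs)
    rw [mem_perp, Fin.forall_fin_one]
    exact ht
  · have key (s t : 𝔤) (hs : B s z = 0) (ht : B t z = 0) (ht' : B t v₁ = 0) :
        B ⁅v₂, s⁆ t = 0 := by
      rw [← lie_skew, map_neg, LinearMap.neg_apply, neg_eq_zero, hB.symm]
      refine hperp ![z, v₁] t ?_ _ (hd₂ s hs)
      rw [mem_perp, Fin.forall_fin_two]
      exact ⟨ht, ht'⟩
    -- `key` needs its second argument orthogonal to `v₁`. Alternation allows swapping the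
    -- arguments, or adding to `t` a multiple of `s` that makes it orthogonal.
    by_cases hs' : B s v₁ = 0
    · rw [hB.lie_skew, key t s ht hs hs', neg_zero]
    · have h1 := key s (B s v₁ • t - B t v₁ • s) hs (by simp [hs, ht]) (by simp [mul_comm])
      rw [map_sub, map_smul, map_smul, hB.lie_apply_right_self, smul_zero, sub_zero, smul_eq_mul,
        mul_eq_zero, or_iff_right hs'] at h1
      exact h1

/-- If `z` and `z₁` are central and `⁅z₂, x₂⁆ ∈ ℂ z` then `z^⊥ / ℂ z` is abelian. -/
theorem IsHyperbolic.lie_apply_eq_zero {z₁ z₂ z x₁ x₂ d : 𝔤}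
    (hh : IsHyperbolic B z₁ z₂ z x₁ x₂ d) (hB : IsQuadratic B) (hdim : Module.finrank ℂ 𝔤 = 6)
    (hz : ∀ u : 𝔤, ⁅u, z⁆ = 0) (hz₁ : ∀ u : 𝔤, ⁅u, z₁⁆ = 0) (h : B ⁅z₂, x₂⁆ x₁ = 0) (x y w : 𝔤)
    (hx : B x z = 0) (hy : B y z = 0) (hw : B w z = 0) : B ⁅x, y⁆ w = 0 := by
  have hli := hh.linearIndependent hB
  have hli3 : LinearIndependent ℂ ![z, z₁, z₂] := by
    have := hli.comp ![2, 0, 1] (by decide)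
    convert this using 1
    ext i; fin_cases i <;> rfl
  have hexp := hh.expand hB hdim
  have hf := hh.flip hB
  simp only [IsHyperbolic] at hh
  have hz' (u : 𝔤) : ⁅z, u⁆ = 0 := by rw [← lie_skew, hz, neg_zero]
  have hz₁' (u : 𝔤) : ⁅z₁, u⁆ = 0 := by rw [← lie_skew, hz₁, neg_zero]
  refine lie_apply_eq_zero_of_linearIndependent hB hdim hz hli3 hh.1.2.2.2.2.2 hh.1.2.2.1
    hh.1.2.2.2.2.1 (fun s t _ _ => by rw [hz₁', map_zero, LinearMap.zero_apply])
    (fun s t hs ht => ?_) x y w hx hy hw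
  rw [hexp s, hexp t, hs, ht]
  simp only [lie_add, lie_smul, hz, hz₁, lie_self, map_add, map_smul, LinearMap.add_apply,
    LinearMap.smul_apply, smul_eq_mul, hB.lie_apply_right_self, h, hB.lie_skew z₂ x₁ x₂,
    hB.lie_left_comm z₂ _ z₂, hB.lie_left_comm z₂ _ z, hB.lie_left_comm z₂ _ z₁, map_zero,
    LinearMap.zero_apply]
  simp

theorem exists_isDoubleExtension (hB : IsQuadratic B) [LieAlgebra.IsSolvable 𝔤]
    (hdim : Module.finrank ℂ 𝔤 = 6) (hc : ∀ y : 𝔤, (∀ u : 𝔤, ⁅u, y⁆ = 0) → B y y = 0) :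
    ∃ z d : 𝔤, IsDoubleExtension B z d := by
  have : FiniteDimensional ℂ 𝔤 := Module.finite_of_finrank_eq_succ hdim
  have : Nontrivial 𝔤 := Module.nontrivial_of_finrank_pos (R := ℂ) (by omega)
  obtain ⟨z, hz, hz0⟩ := exists_central_ne_zero hB
  obtain ⟨d, hzd, hdd⟩ := hB.exists_isotropic_partner hz0 (hc z hz)
  by_cases hcen : ∀ y : 𝔤, (∀ u : 𝔤, ⁅u, y⁆ = 0) → ∃ t : ℂ, y = t • z
  · exact ⟨z, d, isDoubleExtension_of_forall hB hz (hc z hz) hzd hdd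
      (lie_apply_eq_zero_of_center_le hB hdim hz hz0 (hc z hz) hcen)⟩
  push Not at hcen
  obtain ⟨y, hy, hyz⟩ := hcen
  obtain ⟨e, he, he0, hez, hed⟩ :
      ∃ e : 𝔤, (∀ u : 𝔤, ⁅u, e⁆ = 0) ∧ e ≠ 0 ∧ B e z = 0 ∧ B e d = 0 := by
    refine ⟨y - B y d • z, fun u => by simp [hz, hy], sub_ne_zero.2 (hyz _), ?_, ?_⟩
    · have h1 := hc (y + z) fun u => by simp [hz, hy]
      simp only [map_add, LinearMap.add_apply, hc z hz, hc y hy, hB.symm z y] at h1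
      have h2 : B y z = 0 := by linear_combination h1 / 2
      simp [h2, hc z hz]
    · simp [hzd]
  obtain ⟨p, x, q, hh⟩ := exists_isHyperbolic hB hdim (hc z hz) hzd hdd he0 (hc e he) hez hed
  have hf := hh.flip hB
  have hh' := hh
  simp only [IsHyperbolic] at hh'
  by_cases hβ : B ⁅p, q⁆ x = 0
  · exact ⟨z, d, isDoubleExtension_of_forall hB hz (hc z hz) hzd hdd
      (hh.lie_apply_eq_zero hB hdim hz he hβ)⟩
  -- The new central vector `α • z + β • e` is `⁅p, q⁆` itself, so `⁅p, q⁆` vanishes modulo it.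
  set α := B ⁅p, q⁆ d with hα
  set β := B ⁅p, q⁆ x with hβ'
  have hz' (u : 𝔤) : ⁅u, α • z + β • e⁆ = 0 := by simp [hz, he]
  have hh2 : IsHyperbolic B z p (α • z + β • e) (d - (α / β) • x) q (β⁻¹ • x) := by
    simp only [IsHyperbolic]
    simp [hh', hf, hβ]
    field_simp
    simp
  refine ⟨α • z + β • e, β⁻¹ • x, isDoubleExtension_of_forall hB hz' (hc _ hz') ?_ ?_
      (hh2.lie_apply_eq_zero hB hdim hz' hz ?_)⟩
  · simp [hh', hβ]
  · simp [hh']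
  · simp only [map_sub, map_smul, smul_eq_mul, ← hα, ← hβ']
    field_simp
    ring

end Existence

theorem IsQuadratic.iisomorphic_of_isIndecomposable {𝔤 : Type*} [LieRing 𝔤] [LieAlgebra ℂ 𝔤]
    [LieAlgebra.IsSolvable 𝔤] {B : LinearMap.BilinForm ℂ 𝔤} (hB : IsQuadratic B)
    (hdim : Module.finrank ℂ 𝔤 = 6) (hind : IsIndecomposable B) :
    IIsomorphic B B61 ∨ (∃ c : ℂ, c ≠ 0 ∧ IIsomorphic B (B62 c)) ∨ IIsomorphic B B63 := by
  have : FiniteDimensional ℂ 𝔤 := Module.finite_of_finrank_eq_succ hdim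
  have hc := isotropic_of_central hB hind (by omega)
  obtain ⟨z, d, h⟩ := exists_isDoubleExtension hB hdim hc
  exact h.classification hB hdim hc

/-! ### The models as double extensions, and isomorphisms within the second family. -/

namespace Model

variable (M : Matrix (Fin 2) (Fin 2) ℂ)

theorem finrank_eq : Module.finrank ℂ (Model M) = 6 := by
  change Module.finrank ℂ ((Fin 3 → ℂ) × (Fin 3 → ℂ)) = 6
  simp

theorem isHyperbolic : IsHyperbolic (form M) (Z M 0) (Z M 1) (Z M 2) (X M 0) (X M 1) (X M 2) := by
  simp [IsHyperbolic, form_apply]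

theorem isDoubleExtension : IsDoubleExtension (form M) (Z M 2) (X M 2) where
  central u := by
    apply ext' <;> intro i <;> fin_cases i <;>
      simp [lie_fst_zero, lie_fst_one, lie_fst_two, lie_snd_zero, lie_snd_one, lie_snd_two]
  isotropic := by simp [form_apply]
  pairing := by simp [form_apply]
  isotropic_right := by simp [form_apply]
  lie_eq u v hu hv := by
    have hu' : u.2 2 = 0 := by simpa [form_apply, Fin.sum_univ_three] using hu
    have hv' : v.2 2 = 0 := by simpa [form_apply, Fin.sum_univ_three] using hv
    apply ext' <;> intro i <;> fin_cases i <;>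
      simp [lie_fst_zero, lie_fst_one, lie_fst_two, lie_snd_zero, lie_snd_one, lie_snd_two,
        form_apply, Fin.sum_univ_three, hu', hv']
    ring

end Model

open Model

/-- Exchange `Z₂` and `X₂`, whose eigenvalues under `ad X₃` are opposite. -/
theorem iisomorphic_neg (c : ℂ) : IIsomorphic (B62 c) (B62 (-c)) := by
  refine (isDoubleExtension _).iisomorphic (form_isQuadratic _) (finrank_eq _)
    ((isHyperbolic _).swap (form_isQuadratic _)) ?_ ?_ ?_ ?_ ?_ ?_ <;>
  simp [form_apply, lie_fst_zero, lie_fst_one, lie_snd_one]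

/-- Exchange the indices 1 and 2 and divide `X₃` by `c`, multiplying `Z₃` by `c`. -/
theorem iisomorphic_inv {c : ℂ} (hc : c ≠ 0) : IIsomorphic (B62 c) (B62 c⁻¹) := by
  have hh : IsHyperbolic (B62 c) (Z _ 1) (Z _ 0) (Z _ 2) (X _ 1) (X _ 0) (X _ 2) := by
    simp [IsHyperbolic, form_apply]
  refine ((isDoubleExtension _).smul hc).iisomorphic (form_isQuadratic _) (finrank_eq _)
    (hh.smul_third hc) ?_ ?_ ?_ ?_ ?_ ?_ <;>
  simp [form_apply, lie_fst_zero, lie_fst_one, lie_snd_zero, hc]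

/-! ### Eigenvalue invariants separating the models. -/

section Invariants

variable {𝔤 𝔥 𝔨 : Type*} [LieRing 𝔤] [LieAlgebra ℂ 𝔤] [LieRing 𝔥] [LieAlgebra ℂ 𝔥] [LieRing 𝔨]
  [LieAlgebra ℂ 𝔨]

theorem IIsomorphic.trans {B : LinearMap.BilinForm ℂ 𝔤} {B' : LinearMap.BilinForm ℂ 𝔥}
    {B'' : LinearMap.BilinForm ℂ 𝔨} (h : IIsomorphic B B') (h' : IIsomorphic B' B'') :
    IIsomorphic B B'' := by
  obtain ⟨A, hA⟩ := h
  obtain ⟨A', hA'⟩ := h'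
  exact ⟨A.trans A', fun x y => by
    rw [LieEquiv.trans_apply, LieEquiv.trans_apply, hA', hA]⟩

theorem lie_map_eq_smul (A : 𝔤 ≃ₗ⁅ℂ⁆ 𝔥) {u v : 𝔤} {a : ℂ} (h : ⁅u, v⁆ = a • v) :
    ⁅A u, A v⁆ = a • A v := by
  rw [← LieEquiv.map_lie, h, map_smul]

end Invariants

/-- Every `ad u` is nilpotent: the coordinates along `X₃, X₁, Z₂` of a bracket vanish, and the
others depend only on these. -/
theorem G61.eq_zero_of_lie_eq_smul {u v : G61} {a : ℂ} (h : ⁅u, v⁆ = a • v) (hv : v ≠ 0) :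
    a = 0 := by
  by_contra ha
  have h22 := congrArg (fun w : G61 => w.2 2) h
  have h20 := congrArg (fun w : G61 => w.2 0) h
  have h21 := congrArg (fun w : G61 => w.2 1) h
  have h11 := congrArg (fun w : G61 => w.1 1) h
  have h10 := congrArg (fun w : G61 => w.1 0) h
  have h12 := congrArg (fun w : G61 => w.1 2) h
  simp [lie_fst_one, lie_snd_zero, lie_snd_two, ha] at h22 h20 h11
  simp [lie_fst_zero, lie_fst_two, lie_snd_one, ha, h22, h20, h11] at h21 h10 h12
  exact hv (ext' (Fin.forall_fin_succ.2 ⟨h10, Fin.forall_fin_two.2 ⟨h11, h12⟩⟩)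
    (Fin.forall_fin_succ.2 ⟨h20, Fin.forall_fin_two.2 ⟨h21, h22⟩⟩))

/-- The nonzero eigenvalues of `ad u` in `𝔤₆,₂(c)`. -/
theorem G62.eigenvalue {c : ℂ} {u v : G62 c} {a : ℂ} (h : ⁅u, v⁆ = a • v) (hv : v ≠ 0)
    (ha : a ≠ 0) : a ^ 2 = u.2 2 ^ 2 ∨ a ^ 2 = u.2 2 ^ 2 * c ^ 2 := by
  by_contra! hne
  have h22 := congrArg (fun w : G62 c => w.2 2) h
  have h20 := congrArg (fun w : G62 c => w.2 0) h
  have h21 := congrArg (fun w : G62 c => w.2 1) h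
  have h11 := congrArg (fun w : G62 c => w.1 1) h
  have h10 := congrArg (fun w : G62 c => w.1 0) h
  have h12 := congrArg (fun w : G62 c => w.1 2) h
  simp [lie_snd_two, ha] at h22
  simp [lie_fst_zero, lie_fst_one, lie_fst_two, lie_snd_zero, lie_snd_one, h22]
    at h20 h21 h11 h10 h12
  have key {b t : ℂ} (hb : a ^ 2 ≠ b ^ 2) (ht : b * t = a * t) : t = 0 := by
    by_contra ht0
    exact hb (by rw [mul_right_cancel₀ ht0 ht])
  have k10 : v.1 0 = 0 := h10.resolve_left fun h0 => hne.1 (by rw [h0])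
  have k11 : v.1 1 = 0 := key (b := u.2 2 * c) (by rw [mul_pow]; exact hne.2)
    (by linear_combination h11)
  have k20 : v.2 0 = 0 := key (b := -u.2 2) (by rw [neg_sq]; exact hne.1) (by linear_combination h20)
  have k21 : v.2 1 = 0 := key (b := -(u.2 2 * c)) (by rw [neg_sq, mul_pow]; exact hne.2)
    (by linear_combination h21)
  have k12 : v.1 2 = 0 := by simpa [k10, k11, k20, k21, ha] using h12
  exact hv (ext' (Fin.forall_fin_succ.2 ⟨k10, Fin.forall_fin_two.2 ⟨k11, k12⟩⟩)
    (Fin.forall_fin_succ.2 ⟨k20, Fin.forall_fin_two.2 ⟨k21, h22⟩⟩))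

/-- In `𝔤₆,₂(c)` generalized eigenvectors for the eigenvalue one are eigenvectors. -/
theorem G62.lie_eq_self {c : ℂ} {u v : G62 c} (h : ⁅u, ⁅u, v⁆ - v⁆ = ⁅u, v⁆ - v) :
    ⁅u, v⁆ = v := by
  set y := ⁅u, v⁆ - v with hy
  have h22 := congrArg (fun w : G62 c => w.2 2) h
  have h20 := congrArg (fun w : G62 c => w.2 0) h
  have h21 := congrArg (fun w : G62 c => w.2 1) h
  have h11 := congrArg (fun w : G62 c => w.1 1) h
  have h10 := congrArg (fun w : G62 c => w.1 0) h
  have h12 := congrArg (fun w : G62 c => w.1 2) h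
  have y22 := congrArg (fun w : G62 c => w.2 2) hy
  have y20 := congrArg (fun w : G62 c => w.2 0) hy
  have y21 := congrArg (fun w : G62 c => w.2 1) hy
  have y11 := congrArg (fun w : G62 c => w.1 1) hy
  have y10 := congrArg (fun w : G62 c => w.1 0) hy
  simp only [lie_snd_two] at h22
  simp [lie_snd_two, ← h22] at y22
  simp [lie_fst_zero, lie_fst_one, lie_fst_two, lie_snd_zero, lie_snd_one, ← h22, y22]
    at h20 h21 h11 h10 h12 y20 y21 y11 y10
  -- Once the `X₃` coordinates vanish, `ad u` is diagonal modulo `Z₃`; in each coordinate `(b - 1)²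
  -- t = 0` forces `(b - 1) t = 0`.
  have key {b t s : ℂ} (hs : b * s = s) (ht : s = b * t - t) : s = 0 := by
    have h1 : (b - 1) * s = 0 := by linear_combination hs
    rcases mul_eq_zero.1 h1 with h2 | h2
    · rw [ht]; linear_combination t * h2
    · exact h2
  have k10 : y.1 0 = 0 := key (t := v.1 0) (b := u.2 2) (by linear_combination h10)
    (by linear_combination y10)
  have k11 : y.1 1 = 0 := key (t := v.1 1) (b := c * u.2 2) (by linear_combination h11)
    (by linear_combination y11)
  have k20 : y.2 0 = 0 := key (t := v.2 0) (b := -u.2 2) (by linear_combination h20)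
    (by linear_combination y20)
  have k21 : y.2 1 = 0 := key (t := v.2 1) (b := -(c * u.2 2)) (by linear_combination h21)
    (by linear_combination y21)
  have k12 : y.1 2 = 0 := by simpa [k10, k11, k20, k21] using h12.symm
  have hy0 : y = 0 := ext' (Fin.forall_fin_succ.2 ⟨k10, Fin.forall_fin_two.2 ⟨k11, k12⟩⟩)
    (Fin.forall_fin_succ.2 ⟨k20, Fin.forall_fin_two.2 ⟨k21, h22.symm⟩⟩)
  exact sub_eq_zero.1 hy0

theorem Model.Z_ne_zero (M : Matrix (Fin 2) (Fin 2) ℂ) (i : Fin 3) : Z M i ≠ 0 := fun h => by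
  have := congrArg (fun w : Model M => w.1 i) h
  simp at this

theorem not_iisomorphic_B61 {M : Matrix (Fin 2) (Fin 2) ℂ} (h00 : M 0 0 = 1) (h10 : M 1 0 = 0) :
    ¬ IIsomorphic B61 (form M) := by
  rintro ⟨A, -⟩
  have h1 : ⁅X M 2, Z M 0⁆ = (1 : ℂ) • Z M 0 := by simp [(lie_X_two M).1, h00, h10]
  exact one_ne_zero (G61.eq_zero_of_lie_eq_smul (lie_map_eq_smul A.symm h1)
    ((map_ne_zero_iff _ A.symm.injective).2 (Z_ne_zero M 0)))

/-- In `G63`, `ad X₃` has a Jordan block on `Z₁, Z₂` for the eigenvalue 1. -/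
theorem not_iisomorphic_B62_B63 (c : ℂ) : ¬ IIsomorphic (B62 c) B63 := by
  rintro ⟨A, -⟩
  have h0 : ⁅X !![1, 1; 0, 1] 2, Z !![1, 1; 0, 1] 0⁆ = Z !![1, 1; 0, 1] 0 := by
    simp [(lie_X_two !![1, 1; 0, 1]).1]
  have h1 : ⁅X !![1, 1; 0, 1] 2, Z !![1, 1; 0, 1] 1⁆ - Z !![1, 1; 0, 1] 1 =
      Z !![1, 1; 0, 1] 0 := by
    simp [(lie_X_two !![1, 1; 0, 1]).2.1]
  have h2 : ⁅A.symm (X !![1, 1; 0, 1] 2), A.symm (Z !![1, 1; 0, 1] 1)⁆ =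
      A.symm (Z !![1, 1; 0, 1] 1) := by
    apply G62.lie_eq_self
    rw [← LieEquiv.map_lie, ← map_sub, h1, ← LieEquiv.map_lie, h0]
  rw [← LieEquiv.map_lie, ← sub_eq_zero, ← map_sub, h1] at h2
  exact (map_ne_zero_iff _ A.symm.injective).2 (Z_ne_zero _ 0) h2

/-- If `t` is the `X₃` coordinate of the image of `X₃`, both `1` and `c₁ ^ 2` lie in `{t ^ 2, t ^ 2
* c₂ ^ 2}`; being distinct, they are the two different members. -/
theorem sq_eq_or_mul_eq_one {c₁ c₂ : ℂ} (hc₁ : c₁ ≠ 0) (hc : c₁ ^ 2 ≠ 1)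
    (A : G62 c₁ ≃ₗ⁅ℂ⁆ G62 c₂) : c₁ ^ 2 = c₂ ^ 2 ∨ c₁ ^ 2 * c₂ ^ 2 = 1 := by
  have h1 : ⁅X !![1, 0; 0, c₁] 2, Z !![1, 0; 0, c₁] 0⁆ = (1 : ℂ) • Z !![1, 0; 0, c₁] 0 := by
    simp [(lie_X_two !![1, 0; 0, c₁]).1]
  have h2 : ⁅X !![1, 0; 0, c₁] 2, Z !![1, 0; 0, c₁] 1⁆ = c₁ • Z !![1, 0; 0, c₁] 1 := by
    simp [(lie_X_two !![1, 0; 0, c₁]).2.1]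
  have h3 := G62.eigenvalue (lie_map_eq_smul A h1)
    ((map_ne_zero_iff _ A.injective).2 (Z_ne_zero _ 0)) one_ne_zero
  have h4 := G62.eigenvalue (lie_map_eq_smul A h2)
    ((map_ne_zero_iff _ A.injective).2 (Z_ne_zero _ 1)) hc₁
  rw [one_pow] at h3
  rcases h3 with h3 | h3 <;> rcases h4 with h4 | h4
  · exact absurd (h4.trans h3.symm) hc
  · left
    rw [h4, ← h3, one_mul]
  · right
    rw [h4, ← h3]
  · exact absurd (h4.trans h3.symm) hc

theorem eq_or_eq_of_iisomorphic {c₁ c₂ : ℂ} (hc₁ : c₁ ≠ 0) (hc₂ : c₂ ≠ 0)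
    (h : IIsomorphic (B62 c₁) (B62 c₂)) : c₂ = c₁ ∨ c₂ = -c₁ ∨ c₂ = c₁⁻¹ ∨ c₂ = -c₁⁻¹ := by
  obtain ⟨A, -⟩ := h
  have key : c₂ ^ 2 = c₁ ^ 2 ∨ c₂ ^ 2 = c₁⁻¹ ^ 2 := by
    by_cases h1 : c₁ ^ 2 = 1
    · by_cases h2 : c₂ ^ 2 = 1
      · exact Or.inl (h2.trans h1.symm)
      -- The eigenvalue comparison needs distinct squares in the source, so it is applied to the
      -- inverse map.
      · refine (sq_eq_or_mul_eq_one hc₂ h2 A.symm).imp id fun h => ?_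
        rw [inv_pow]
        exact eq_inv_of_mul_eq_one_left h
    · refine (sq_eq_or_mul_eq_one hc₁ h1 A).imp Eq.symm fun h => ?_
      rw [inv_pow]
      exact eq_inv_of_mul_eq_one_right h
  simpa only [sq_eq_sq_iff_eq_or_eq_neg, or_assoc] using key

theorem iisomorphic_B62_iff {c₁ c₂ : ℂ} (hc₁ : c₁ ≠ 0) (hc₂ : c₂ ≠ 0) :
    IIsomorphic (B62 c₁) (B62 c₂) ↔ c₂ = c₁ ∨ c₂ = -c₁ ∨ c₂ = c₁⁻¹ ∨ c₂ = -c₁⁻¹ := by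
  refine ⟨eq_or_eq_of_iisomorphic hc₁ hc₂, ?_⟩
  rintro (rfl | rfl | rfl | rfl)
  · exact ⟨LieEquiv.refl, fun _ _ => rfl⟩
  · exact iisomorphic_neg c₁
  · exact iisomorphic_inv hc₁
  · exact (iisomorphic_inv hc₁).trans (iisomorphic_neg c₁⁻¹)

end QuadLie

theorem mainTheorem1 :
    (∀ (𝔤 : Type*) [LieRing 𝔤] [LieAlgebra ℂ 𝔤] (B : LinearMap.BilinForm ℂ 𝔤),
      Module.finrank ℂ 𝔤 = 6 → LieAlgebra.IsSolvable 𝔤 → QuadLie.IsQuadratic B →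
      QuadLie.IsIndecomposable B →
        QuadLie.IIsomorphic B QuadLie.B61 ∨
        (∃ c : ℂ, c ≠ 0 ∧ QuadLie.IIsomorphic B (QuadLie.B62 c)) ∨
        QuadLie.IIsomorphic B QuadLie.B63) ∧
    (∀ c : ℂ, c ≠ 0 → ¬ QuadLie.IIsomorphic QuadLie.B61 (QuadLie.B62 c)) ∧
    ¬ QuadLie.IIsomorphic QuadLie.B61 QuadLie.B63 ∧
    (∀ c : ℂ, c ≠ 0 → ¬ QuadLie.IIsomorphic (QuadLie.B62 c) QuadLie.B63) ∧
    (∀ c₁ c₂ : ℂ, c₁ ≠ 0 → c₂ ≠ 0 →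
      (QuadLie.IIsomorphic (QuadLie.B62 c₁) (QuadLie.B62 c₂) ↔
        c₂ = c₁ ∨ c₂ = -c₁ ∨ c₂ = c₁⁻¹ ∨ c₂ = -c₁⁻¹)) := by
  refine ⟨fun 𝔤 _ _ B hdim hsol hB hind => hB.iisomorphic_of_isIndecomposable hdim hind,
    fun c _ => QuadLie.not_iisomorphic_B61 rfl rfl, QuadLie.not_iisomorphic_B61 rfl rfl,
    fun c _ => QuadLie.not_iisomorphic_B62_B63 c,
    fun c₁ c₂ hc₁ hc₂ => QuadLie.iisomorphic_B62_iff hc₁ hc₂⟩
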